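/- Let $(\mathcal M,g)$ be a spacetime: a smooth four-dimensional (Hausdorff, second countable) manifold with a smooth Lorentzian metric $g$ of signature $(+,-,-,-)$ and a time orientation, let $\nabla$ be the Levi-Civita connection of $g$, and let $T_{ab}$ be the energy-momentum tensor. Let $\mathcal H$ be a non-expanding horizon in $\mathcal M$, i.e. a smoothly embedded three-dimensional null hypersurface $\psi:\mathcal H\to\mathcal M$ (the induced metric is degenerate at every point), homeomorphic to $\mathbb R\times S^2$, such that 1. every null normal $l^a$ of $\mathcal H$ (a smooth nowhere vanishing null vector field along $\mathcal H$, orthogonal to $T\mathcal H$) has vanishing expansion $q^{ab}\nabla_a l_b=0$ on $\mathcal H$, where $q^{ab}=-(e_1^ae_1^b+e_2^ae_2^b)$ for any two vectors $e_1,e_2$ tangent to $\mathcal H$ with $g(e_i,e_j)=-\delta_{ij}$; 2. Einstein's equations $\mathrm{Ric}_{ab}-\tfrac12 R\,g_{ab}=8\pi T_{ab}$ hold on $\mathcal H$ (with $\mathrm{Ric}(u,v)=\operatorname{tr}(w\mapsto R(w,u)v)$ and $R(u,v)w=\nabla_u\nabla_vw-\nabla_v\nabla_uw-\nabla_{[u,v]}w$);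 3. for every future pointing null normal $l^a$, the vector $T^a{}_b\,l^b$ is future pointing (causal and future directed, or zero) on $\mathcal H$. Then the restriction of $\nabla$ to $\mathcal H$, $$X^a\mathcal D_aY^b = X^a\nabla_aY^b\quad\text{on }\mathcal H,\qquad X,\,Y \text{ tangent to }\mathcal H,$$ is a well-defined covariant derivative on $T\mathcal H$. In detail: every vector field $Y$ on $\mathcal H$ which is differentiable at $p\in\mathcal H$ has, near $p$, an extension $\tilde Y$ to a vector field on $\mathcal M$ which is differentiable at $\psi(p)$; and there is a smooth covariant derivative $\mathcal D$ on $T\mathcal H$, uniquely determined on differentiable vector fields, such that $$\mathrm d\psi_p(\mathcal D_XY)=\nabla_{\mathrm d\psi_p X}\tilde Y$$ for all $p\in\mathcal H$, $X\in T_p\mathcal H$, all $Y$ differentiable at $p$ and all such extensions $\tilde Y$. In particular, the right-hand side is tangent to $\mathcal H$ and does not depend on the extension. -/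

import Mathlib

open scoped Manifold ContDiff Topology

/-- The model space of a four-dimensional spacetime. -/
abbrev E4 : Type := EuclideanSpace ℝ (Fin 4)

/-- The model space of a three-dimensional hypersurface. -/
abbrev E3 : Type := EuclideanSpace ℝ (Fin 3)

/-- The vector field `Y` on an `n`-manifold is differentiable at `x`. -/
abbrev FieldDiffAt {n : ℕ} {N : Type*} [TopologicalSpace N]
    [ChartedSpace (EuclideanSpace ℝ (Fin n)) N] [IsManifold (𝓡 n) ∞ N]
    (Y : Π x : N, TangentSpace (𝓡 n) x) (x : N) : Prop :=
  MDifferentiableAt (𝓡 n) ((𝓡 n).prod 𝓘(ℝ, EuclideanSpace ℝ (Fin n))) (T% Y) x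

section Spacetime

variable {M : Type*} [TopologicalSpace M] [ChartedSpace E4 M] [IsManifold (𝓡 4) ∞ M]

/-- A smooth Lorentzian metric of signature `(+,-,-,-)` on a four-manifold. -/
structure LorentzianMetric (M : Type*) [TopologicalSpace M] [ChartedSpace E4 M]
    [IsManifold (𝓡 4) ∞ M] where
  inner (x : M) : TangentSpace (𝓡 4) x →L[ℝ] TangentSpace (𝓡 4) x →L[ℝ] ℝ
  symm (x : M) (v w : TangentSpace (𝓡 4) x) : inner x v w = inner x w v
  signature (x : M) : ∃ b : Module.Basis (Fin 4) ℝ (TangentSpace (𝓡 4) x),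
    ∀ i j, inner x (b i) (b j) = if i = j then (if i = 0 then 1 else -1) else 0
  contMDiff : ContMDiff (𝓡 4) ((𝓡 4).prod 𝓘(ℝ, E4 →L[ℝ] E4 →L[ℝ] ℝ)) ∞
    (fun x ↦ Bundle.TotalSpace.mk' (E4 →L[ℝ] E4 →L[ℝ] ℝ)
      (E := fun x : M ↦ TangentSpace (𝓡 4) x →L[ℝ] TangentSpace (𝓡 4) x →L[ℝ] ℝ) x (inner x))

/-- A time orientation: a smooth everywhere timelike vector field, declared to be
future pointing. -/
structure TimeOrientation (g : LorentzianMetric M) where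
  field (x : M) : TangentSpace (𝓡 4) x
  timelike (x : M) : 0 < g.inner x (field x) (field x)
  contMDiff : ContMDiff (𝓡 4) ((𝓡 4).prod 𝓘(ℝ, E4)) ∞
    (fun x ↦ Bundle.TotalSpace.mk' E4 (E := fun x : M ↦ TangentSpace (𝓡 4) x) x (field x))

/-- `v` lies in the closed future causal cone at `x` (the zero vector is included, so that
a vacuum satisfies the energy condition of a non-expanding horizon). -/
def TimeOrientation.IsFuturePointing {g : LorentzianMetric M} (τ : TimeOrientation g) (x : M)
    (v : TangentSpace (𝓡 4) x) : Prop :=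
  0 ≤ g.inner x v v ∧ 0 ≤ g.inner x (τ.field x) v

/-- A connection on `TM`. In Mathlib's convention `nabla Y x v` is `∇_v Y` at `x`. -/
abbrev AffineConnection (M : Type*) [TopologicalSpace M] [ChartedSpace E4 M]
    [IsManifold (𝓡 4) ∞ M] :=
  CovariantDerivative (𝓡 4) E4 (fun x : M ↦ TangentSpace (𝓡 4) x)

/-- `nabla` is the Levi-Civita connection of `g`: it is torsion-free and compatible with `g`. -/
structure LorentzianMetric.IsLeviCivita (g : LorentzianMetric M) (nabla : AffineConnection M) :
    Prop where
  torsion_free : nabla.torsion = 0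
  metric : ∀ (Y Z : Π x : M, TangentSpace (𝓡 4) x) (x : M) (v : TangentSpace (𝓡 4) x),
    FieldDiffAt Y x → FieldDiffAt Z x →
      mvfderiv (𝓡 4) (fun y : M ↦ g.inner y (Y y) (Z y)) x v =
        g.inner x (nabla Y x v) (Z x) + g.inner x (Y x) (nabla Z x v)

/-- The Riemann curvature `R(u, v) w = ∇_u ∇_v w - ∇_v ∇_u w - ∇_[u, v] w` at `x`, computed with
extensions of the vectors `u`, `v`, `w` to vector fields which are smooth near `x`. -/
noncomputable def AffineConnection.curvature (nabla : AffineConnection M) (x : M)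
    (u v w : TangentSpace (𝓡 4) x) : TangentSpace (𝓡 4) x :=
  let U : Π y : M, TangentSpace (𝓡 4) y := FiberBundle.extend E4 u
  let V : Π y : M, TangentSpace (𝓡 4) y := FiberBundle.extend E4 v
  let W : Π y : M, TangentSpace (𝓡 4) y := FiberBundle.extend E4 w
  nabla (fun y ↦ nabla W y (V y)) x u - nabla (fun y ↦ nabla W y (U y)) x v
    - nabla W x (VectorField.mlieBracket (𝓡 4) U V x)

/-- A `g`-orthonormal basis of the tangent space at `x`. -/
noncomputable def LorentzianMetric.frame (g : LorentzianMetric M) (x : M) :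
    Module.Basis (Fin 4) ℝ (TangentSpace (𝓡 4) x) :=
  (g.signature x).choose

/-- The Ricci tensor `Ric(u, v)`, the trace of `w ↦ R(w, u) v`. -/
noncomputable def LorentzianMetric.ricci (g : LorentzianMetric M) (nabla : AffineConnection M)
    (x : M) (u v : TangentSpace (𝓡 4) x) : ℝ :=
  ∑ i, (g.frame x).repr (AffineConnection.curvature nabla x (g.frame x i) u v) i

/-- The scalar curvature, the `g`-trace of the Ricci tensor. -/
noncomputable def LorentzianMetric.scalarCurvature (g : LorentzianMetric M)
    (nabla : AffineConnection M) (x : M) : ℝ :=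
  ∑ i, g.inner x (g.frame x i) (g.frame x i) * g.ricci nabla x (g.frame x i) (g.frame x i)

/-- Einstein's equations `Ric - (1/2) R g = 8 π T` at the point `x`, in units `G = c = 1`. -/
def LorentzianMetric.EinsteinAt (g : LorentzianMetric M) (nabla : AffineConnection M)
    (T : Π x : M, TangentSpace (𝓡 4) x →ₗ[ℝ] TangentSpace (𝓡 4) x →ₗ[ℝ] ℝ) (x : M) : Prop :=
  ∀ u v : TangentSpace (𝓡 4) x,
    g.ricci nabla x u v - (1 / 2) * g.scalarCurvature nabla x * g.inner x u v =
      8 * Real.pi * T x u v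

end Spacetime

section Hypersurface

variable {M : Type*} [TopologicalSpace M] [ChartedSpace E4 M] [IsManifold (𝓡 4) ∞ M]
  {H : Type*} [TopologicalSpace H] [ChartedSpace E3 H] [IsManifold (𝓡 3) ∞ H]

/-- The differential of `ψ : H → M` at `p`, identifying `T_p H` with the tangent vectors of the
hypersurface at `ψ p`. -/
noncomputable abbrev pushforward (ψ : H → M) (p : H) :
    TangentSpace (𝓡 3) p →L[ℝ] TangentSpace (𝓡 4) (ψ p) :=
  mfderiv (𝓡 3) (𝓡 4) ψ p

/-- Near `p`, the vector field `V` of `M` restricts along `ψ` to the field `W` along `ψ`. -/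
def ExtendsAt (ψ : H → M) (V : Π x : M, TangentSpace (𝓡 4) x)
    (W : Π q : H, TangentSpace (𝓡 4) (ψ q)) (p : H) : Prop :=
  ∀ᶠ q in 𝓝 p, V (ψ q) = W q

/-- The hypersurface is null: the metric induced on each of its tangent spaces is degenerate. -/
def IsNullHypersurface (g : LorentzianMetric M) (ψ : H → M) : Prop :=
  ∀ p : H, ∃ l : TangentSpace (𝓡 3) p, l ≠ 0 ∧ ∀ X : TangentSpace (𝓡 3) p,
    g.inner (ψ p) (pushforward ψ p l) (pushforward ψ p X) = 0

/-- `l` is a null normal of the hypersurface: a smooth nowhere vanishing null vector field along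
it, orthogonal to all its tangent vectors. -/
structure IsNullNormal (g : LorentzianMetric M) (ψ : H → M)
    (l : Π p : H, TangentSpace (𝓡 4) (ψ p)) : Prop where
  contMDiff : ContMDiff (𝓡 3) ((𝓡 4).prod 𝓘(ℝ, E4)) ∞
    (fun p ↦ Bundle.TotalSpace.mk' E4 (E := fun x : M ↦ TangentSpace (𝓡 4) x) (ψ p) (l p))
  ne_zero (p : H) : l p ≠ 0
  null (p : H) : g.inner (ψ p) (l p) (l p) = 0
  normal (p : H) (X : TangentSpace (𝓡 3) p) : g.inner (ψ p) (l p) (pushforward ψ p X) = 0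

/-- The null normal `l` has expansion `θ` at `p`. The expansion is `q^{ab} ∇_a l_b`, where
`q^{ab} = -m^a m̄^b - m̄^a m^b = -(e₁^a e₁^b + e₂^a e₂^b)` for an orthonormal pair `e₁`, `e₂` of
spacelike tangent vectors of the hypersurface and `m = (e₁ + i e₂) / √2`; the derivatives, being
in tangent directions, are computed with extensions `L` of `l` off the hypersurface. -/
def HasExpansionAt (g : LorentzianMetric M) (nabla : AffineConnection M) (ψ : H → M)
    (l : Π p : H, TangentSpace (𝓡 4) (ψ p)) (p : H) (θ : ℝ) : Prop :=
  ∀ L : Π x : M, TangentSpace (𝓡 4) x,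
    ContMDiffAt (𝓡 4) ((𝓡 4).prod 𝓘(ℝ, E4)) ∞ (T% L) (ψ p) → ExtendsAt ψ L l p →
    ∀ e₁ e₂ : TangentSpace (𝓡 3) p,
      g.inner (ψ p) (pushforward ψ p e₁) (pushforward ψ p e₁) = -1 →
      g.inner (ψ p) (pushforward ψ p e₂) (pushforward ψ p e₂) = -1 →
      g.inner (ψ p) (pushforward ψ p e₁) (pushforward ψ p e₂) = 0 →
      -(g.inner (ψ p) (nabla L (ψ p) (pushforward ψ p e₁)) (pushforward ψ p e₁)
        + g.inner (ψ p) (nabla L (ψ p) (pushforward ψ p e₂)) (pushforward ψ p e₂)) = θ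

/-- The embedding `ψ : H → M` is a non-expanding horizon in the spacetime `(M, g)`, time-oriented
by `τ`, with Levi-Civita connection `nabla` and energy-momentum tensor `T`. -/
structure IsNonExpandingHorizon (g : LorentzianMetric M) (τ : TimeOrientation g)
    (nabla : AffineConnection M)
    (T : Π x : M, TangentSpace (𝓡 4) x →ₗ[ℝ] TangentSpace (𝓡 4) x →ₗ[ℝ] ℝ)
    (ψ : H → M) : Prop where
  embedding : Manifold.IsSmoothEmbedding (𝓡 3) (𝓡 4) ∞ ψ
  null : IsNullHypersurface g ψ
  topology : Nonempty (H ≃ₜ ℝ × Metric.sphere (0 : EuclideanSpace ℝ (Fin 3)) 1)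
  expansion : ∀ l : Π p : H, TangentSpace (𝓡 4) (ψ p), IsNullNormal g ψ l →
    ∀ p : H, HasExpansionAt g nabla ψ l p 0
  einstein : ∀ p : H, g.EinsteinAt nabla T (ψ p)
  /-- The vector `P`, obtained from `T_{ab} l^b` by raising the index, is future pointing. -/
  energy : ∀ l : Π p : H, TangentSpace (𝓡 4) (ψ p), IsNullNormal g ψ l →
    (∀ p : H, τ.IsFuturePointing (ψ p) (l p)) →
    ∀ p : H, ∃ P : TangentSpace (𝓡 4) (ψ p),
      (∀ v, g.inner (ψ p) P v = T (ψ p) v (l p)) ∧ τ.IsFuturePointing (ψ p) P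

/-- A vector field `Y` on the hypersurface, seen as a field along `ψ` with values in `TM`. -/
noncomputable def alongField (ψ : H → M) (Y : Π p : H, TangentSpace (𝓡 3) p) (p : H) :
    TangentSpace (𝓡 4) (ψ p) :=
  pushforward ψ p (Y p)

/-- `D` is the restriction of `nabla` to the hypersurface: `X^a D_a Y^b = X^a ∇_a Y^b` for tangent
vectors `X` and tangent vector fields `Y`, where `∇_X Y` is computed with an arbitrary
differentiable extension of `Y` off the hypersurface. -/
def IsInducedBy (nabla : AffineConnection M) (ψ : H → M)
    (D : CovariantDerivative (𝓡 3) E3 (fun p : H ↦ TangentSpace (𝓡 3) p)) : Prop :=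
  ∀ (p : H) (X : TangentSpace (𝓡 3) p) (Y : Π q : H, TangentSpace (𝓡 3) q)
    (Z : Π x : M, TangentSpace (𝓡 4) x),
    FieldDiffAt Y p → FieldDiffAt Z (ψ p) → ExtendsAt ψ Z (alongField ψ Y) p →
      pushforward ψ p (D Y p X) = nabla Z (ψ p) (pushforward ψ p X)

end Hypersurface

/-! The real obstruction is tangency of `∇_X Y`. Fix a null normal `l`. The tangent space of the
horizon is the orthogonal complement of `l`, so `∇_X Y` is tangent exactly when `g(∇_X Y, l) = 0`.
Differentiating `g(Y, l) = 0` along the horizon turns this into the vanishing of the second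
fundamental form `K(X, Y) = g(∇_X l, Y)`.

`K` is symmetric because the torsion vanishes, and it annihilates the direction of `l`. It therefore
lives on a two-dimensional quotient on which the metric is negative definite, and zero expansion
says that it is trace-free there. Differentiating this trace along the null generators gives
Raychaudhuri's equation, which for zero expansion reads `|K|² + Ric(l, l) = 0`. Einstein's equations
give `Ric(l, l) = 8π T(l, l)` since `l` is null, and `T(l, l)` is the product of two future pointing
causal vectors, hence nonnegative. So `K = 0`. The evolution of `K` is `fderiv_nullSecondForm`, the
differentiable form of the trace condition is `trace_eq_zero_of_orthonormal`, the link with the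
Ricci tensor is `ricci_null`, and the sign comes from `nonneg_of_future`.

The remaining points are about regularity. In charts `∇` along the horizon becomes `covAlong`, which
sees a field only through its values along the map; this gives independence of the extension. The
connection is not assumed smooth: Koszul's formula supplies smooth Christoffel symbols
(`contDiffOn_christoffel`). A smooth global null normal is singled out by `g(τ, l) = 1`
(`contMDiff_of_normal`). Smooth local left inverses of the immersion extend fields off the horizon,
pull derivatives back to it, and make the induced connection smooth. -/

/-! ### Calculus along a parametrized hypersurface -/

section AlongMap

variable {U V : Type*} [NormedAddCommGroup U] [NormedSpace ℝ U]
  [NormedAddCommGroup V] [NormedSpace ℝ V]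

/-- The covariant derivative, with Christoffel symbols `Γ`, of a vector field `W` along `f`. -/
noncomputable def covAlong (Γ : V → V →L[ℝ] V →L[ℝ] V) (f W : U → V) (q : U) : U →L[ℝ] V :=
  fderiv ℝ W q + (Γ (f q) (W q)) ∘L fderiv ℝ f q

/-- The curvature `R(u, v) w` of the connection with Christoffel symbols `Γ`. -/
noncomputable def christoffelCurvature (Γ : V → V →L[ℝ] V →L[ℝ] V) (z u v w : V) : V :=
  fderiv ℝ Γ z u w v - fderiv ℝ Γ z v w u + Γ z (Γ z w v) u - Γ z (Γ z w u) v

variable {Γ : V → V →L[ℝ] V →L[ℝ] V} {G : V → V →L[ℝ] V →L[ℝ] ℝ} {f W W' : U → V} {q : U}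

lemma covAlong_apply (X : U) :
    covAlong Γ f W q X = fderiv ℝ W q X + Γ (f q) (W q) (fderiv ℝ f q X) := rfl

lemma covAlong_congr (h : W =ᶠ[𝓝 q] W') : covAlong Γ f W q = covAlong Γ f W' q := by
  simp [covAlong, h.fderiv_eq, h.eq_of_nhds]

lemma fderiv_metric_along (hf : DifferentiableAt ℝ f q) (hW : DifferentiableAt ℝ W q)
    (hW' : DifferentiableAt ℝ W' q) (hG : DifferentiableAt ℝ G (f q))
    (hcompat : ∀ a b v, fderiv ℝ G (f q) v a b = G (f q) (Γ (f q) a v) b + G (f q) a (Γ (f q) b v))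
    (X : U) :
    fderiv ℝ (fun q ↦ G (f q) (W q) (W' q)) q X =
      G (f q) (covAlong Γ f W q X) (W' q) + G (f q) (W q) (covAlong Γ f W' q X) := by
  have h0 : HasFDerivAt (fun q ↦ G (f q)) (fderiv ℝ G (f q) ∘L fderiv ℝ f q) q :=
    HasFDerivAt.comp (G := V →L[ℝ] V →L[ℝ] ℝ) (g := G) q hG.hasFDerivAt hf.hasFDerivAt
  have h := (h0.clm_apply hW.hasFDerivAt).clm_apply hW'.hasFDerivAt
  have := h.fderiv
  rw [this]
  simp [covAlong_apply, hcompat]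
  ring

/-- Constant fields commute, so this is vanishing torsion along `f`: the second derivative of `f`
and the Christoffel symbols are both symmetric. -/
lemma covAlong_fderiv_comm (hf : ContDiffAt ℝ 2 f q)
    (hΓ : ∀ a b, Γ (f q) a b = Γ (f q) b a) (X Y : U) :
    covAlong Γ f (fun q ↦ fderiv ℝ f q Y) q X = covAlong Γ f (fun q ↦ fderiv ℝ f q X) q Y := by
  have hd : DifferentiableAt ℝ (fderiv ℝ f) q :=
    (hf.fderiv_right (m := 1) (by norm_num)).differentiableAt (by norm_num)
  have hs : IsSymmSndFDerivAt ℝ f q := hf.isSymmSndFDerivAt (by simp)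
  rw [covAlong_apply, covAlong_apply, hΓ]
  rw [fderiv_clm_apply hd (by fun_prop), fderiv_clm_apply hd (by fun_prop)]
  simp [hs.eq X Y]

lemma differentiableAt_covAlong (hf : ContDiffAt ℝ 2 f q) (hW : ContDiffAt ℝ 2 W q)
    (hΓ : DifferentiableAt ℝ Γ (f q)) : DifferentiableAt ℝ (covAlong Γ f W) q := by
  have hd : DifferentiableAt ℝ (fderiv ℝ f) q :=
    (hf.fderiv_right (m := 1) (by norm_num)).differentiableAt (by norm_num)
  have hdW : DifferentiableAt ℝ (fderiv ℝ W) q :=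
    (hW.fderiv_right (m := 1) (by norm_num)).differentiableAt (by norm_num)
  have h1 : DifferentiableAt ℝ (fun q ↦ Γ (f q)) q :=
    DifferentiableAt.comp (G := V →L[ℝ] V →L[ℝ] V) (g := Γ) q hΓ (hf.differentiableAt (by norm_num))
  have h2 := h1.clm_apply (hW.differentiableAt (by norm_num))
  exact hdW.add (h2.clm_comp hd)

/-- The Ricci identity along `f`. There is no bracket term because `X` and `Y` are constant; the
second derivatives of `f` and of `W` cancel by symmetry. -/
lemma covAlong_comm (hf : ContDiffAt ℝ 2 f q) (hW : ContDiffAt ℝ 2 W q)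
    (hΓ : DifferentiableAt ℝ Γ (f q)) (X Y : U) :
    covAlong Γ f (fun q ↦ covAlong Γ f W q Y) q X - covAlong Γ f (fun q ↦ covAlong Γ f W q X) q Y =
      christoffelCurvature Γ (f q) (fderiv ℝ f q X) (fderiv ℝ f q Y) (W q) := by
  have hd : DifferentiableAt ℝ (fderiv ℝ f) q :=
    (hf.fderiv_right (m := 1) (by norm_num)).differentiableAt (by norm_num)
  have hdW : DifferentiableAt ℝ (fderiv ℝ W) q :=
    (hW.fderiv_right (m := 1) (by norm_num)).differentiableAt (by norm_num)
  have hs : IsSymmSndFDerivAt ℝ f q := hf.isSymmSndFDerivAt (by simp)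
  have hsW : IsSymmSndFDerivAt ℝ W q := hW.isSymmSndFDerivAt (by simp)
  have hf1 : DifferentiableAt ℝ f q := hf.differentiableAt (by norm_num)
  have hW1 : DifferentiableAt ℝ W q := hW.differentiableAt (by norm_num)
  have key (X Y : U) : fderiv ℝ (fun q ↦ covAlong Γ f W q Y) q X =
      fderiv ℝ (fderiv ℝ W) q X Y + fderiv ℝ Γ (f q) (fderiv ℝ f q X) (W q) (fderiv ℝ f q Y)
        + Γ (f q) (fderiv ℝ W q X) (fderiv ℝ f q Y)
        + Γ (f q) (W q) (fderiv ℝ (fderiv ℝ f) q X Y) := by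
    have h0 : HasFDerivAt (fun q ↦ Γ (f q)) (fderiv ℝ Γ (f q) ∘L fderiv ℝ f q) q :=
      HasFDerivAt.comp (G := V →L[ℝ] V →L[ℝ] V) (g := Γ) q hΓ.hasFDerivAt hf1.hasFDerivAt
    have h1 := (h0.clm_apply hW1.hasFDerivAt).clm_apply
      (hd.hasFDerivAt.clm_apply (hasFDerivAt_const Y q))
    have h2 := (hdW.hasFDerivAt.clm_apply (hasFDerivAt_const Y q)).add h1
    have := h2.fderiv
    have e : (fun q ↦ covAlong Γ f W q Y) = ((fun y ↦ fderiv ℝ W y Y) +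
      fun y ↦ Γ (f y) (W y) (fderiv ℝ f y Y)) := rfl
    rw [e, this]
    simp
    abel
  rw [covAlong_apply X, covAlong_apply (W := fun q ↦ covAlong Γ f W q X) Y, key, key,
    hsW.eq X Y, hs.eq X Y, christoffelCurvature]
  simp only [covAlong_apply, map_add, add_apply]
  abel

/-- Leibniz rule that freezes `μ` at `q`. The identities above concern constant directions, whereas
the null generator varies; the last term is the price of replacing it by a constant. -/
lemma covAlong_clm_apply {A : U → U →L[ℝ] V} {μ : U → U} (hA : DifferentiableAt ℝ A q)
    (hμ : DifferentiableAt ℝ μ q) (X : U) :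
    covAlong Γ f (fun q ↦ A q (μ q)) q X =
      covAlong Γ f (fun q' ↦ A q' (μ q)) q X + A q (fderiv ℝ μ q X) := by
  rw [covAlong_apply, covAlong_apply, fderiv_clm_apply hA hμ,
    fderiv_clm_apply hA (differentiableAt_const _)]
  simp
  abel

end AlongMap

/-! ### The second fundamental form of a null hypersurface in a chart, and its evolution -/

section NullHypersurface

variable {U V : Type*} [NormedAddCommGroup U] [NormedSpace ℝ U]
  [NormedAddCommGroup V] [NormedSpace ℝ V]

/-- Near `p`, the map `f` parametrizes a null hypersurface of the metric `G` with Christoffel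
symbols `Γ`; its null normal is `l = df(μ)`. -/
structure ParamNullHypersurfaceAt (G : V → V →L[ℝ] V →L[ℝ] ℝ) (Γ : V → V →L[ℝ] V →L[ℝ] V)
    (f l : U → V) (μ : U → U) (p : U) : Prop where
  contDiffAt_map : ContDiffAt ℝ 3 f p
  contDiffAt_normal : ContDiffAt ℝ 3 l p
  contDiffAt_generator : ContDiffAt ℝ 1 μ p
  contDiffAt_metric : ContDiffAt ℝ 1 G (f p)
  contDiffAt_christoffel : ContDiffAt ℝ 1 Γ (f p)
  metric_symm : ∀ᶠ z in 𝓝 (f p), ∀ a b, G z a b = G z b a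
  christoffel_symm : ∀ᶠ z in 𝓝 (f p), ∀ a b, Γ z a b = Γ z b a
  compat : ∀ᶠ z in 𝓝 (f p), ∀ a b v,
    fderiv ℝ G z v a b = G z (Γ z a v) b + G z a (Γ z b v)
  normal_eq : ∀ᶠ q in 𝓝 p, l q = fderiv ℝ f q (μ q)
  normal : ∀ᶠ q in 𝓝 p, ∀ X, G (f q) (l q) (fderiv ℝ f q X) = 0

/-- The second fundamental form `G(∇_X l, Y)` of the null normal `l`. -/
noncomputable def nullSecondForm (G : V → V →L[ℝ] V →L[ℝ] ℝ) (Γ : V → V →L[ℝ] V →L[ℝ] V)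
    (f l : U → V) (q X Y : U) : ℝ :=
  G (f q) (covAlong Γ f l q X) (fderiv ℝ f q Y)

namespace ParamNullHypersurfaceAt

variable {G : V → V →L[ℝ] V →L[ℝ] ℝ} {Γ : V → V →L[ℝ] V →L[ℝ] V} {f l : U → V} {μ : U → U} {p : U}

/-- Needed so that pointwise identities can be differentiated. The structure asks for finite orders
of differentiability because these persist near a point, while infinite order at a single point need
not. -/
lemma eventually (h : ParamNullHypersurfaceAt G Γ f l μ p) :
    ∀ᶠ q in 𝓝 p, ParamNullHypersurfaceAt G Γ f l μ q := by
  have hc := h.contDiffAt_map.continuousAt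
  filter_upwards [h.contDiffAt_map.eventually (by simp), h.contDiffAt_normal.eventually (by simp),
    h.contDiffAt_generator.eventually (by simp),
    hc.eventually (h.contDiffAt_metric.eventually (by simp)),
    hc.eventually (h.contDiffAt_christoffel.eventually (by simp)),
    hc.eventually (eventually_eventually_nhds.2 h.metric_symm),
    hc.eventually (eventually_eventually_nhds.2 h.christoffel_symm),
    hc.eventually (eventually_eventually_nhds.2 h.compat),
    eventually_eventually_nhds.2 h.normal_eq, eventually_eventually_nhds.2 h.normal]
    with q h1 h2 h3 h4 h5 h6 h7 h8 h9 h10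
  exact ⟨h1, h2, h3, h4, h5, h6, h7, h8, h9, h10⟩

lemma differentiableAt_fderiv (h : ParamNullHypersurfaceAt G Γ f l μ p) :
    DifferentiableAt ℝ (fderiv ℝ f) p :=
  (h.contDiffAt_map.fderiv_right (m := 1) (by norm_num)).differentiableAt (by norm_num)

lemma differentiableAt_covAlong (h : ParamNullHypersurfaceAt G Γ f l μ p) :
    DifferentiableAt ℝ (covAlong Γ f l) p :=
  _root_.differentiableAt_covAlong (h.contDiffAt_map.of_le (by norm_num))
    (h.contDiffAt_normal.of_le (by norm_num))
    (h.contDiffAt_christoffel.differentiableAt (by norm_num))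

lemma fderiv_metric (h : ParamNullHypersurfaceAt G Γ f l μ p) {W W' : U → V}
    (hW : DifferentiableAt ℝ W p) (hW' : DifferentiableAt ℝ W' p) (X : U) :
    fderiv ℝ (fun q ↦ G (f q) (W q) (W' q)) p X =
      G (f p) (covAlong Γ f W p X) (W' p) + G (f p) (W p) (covAlong Γ f W' p X) :=
  fderiv_metric_along (h.contDiffAt_map.differentiableAt (by norm_num)) hW hW'
    (h.contDiffAt_metric.differentiableAt (by norm_num)) h.compat.self_of_nhds X

/-- Differentiate `G(l, df Y) = 0` in the direction `X`. In this form the symmetry of the second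
fundamental form reduces to `covAlong_fderiv_comm`. -/
lemma nullSecondForm_eq (h : ParamNullHypersurfaceAt G Γ f l μ p) (X Y : U) :
    nullSecondForm G Γ f l p X Y =
      -G (f p) (l p) (covAlong Γ f (fun q ↦ fderiv ℝ f q Y) p X) := by
  have h1 := h.fderiv_metric (h.contDiffAt_normal.differentiableAt (by norm_num))
    (W' := fun q ↦ fderiv ℝ f q Y)
    (h.differentiableAt_fderiv.clm_apply (differentiableAt_const _)) X
  have h2 : (fun q ↦ G (f q) (l q) (fderiv ℝ f q Y)) =ᶠ[𝓝 p] fun _ ↦ 0 :=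
    h.normal.mono fun q hq ↦ hq Y
  rw [h2.fderiv_eq] at h1
  simp only [fderiv_fun_const, Pi.zero_apply, zero_apply] at h1
  rw [nullSecondForm]
  linarith

lemma nullSecondForm_symm (h : ParamNullHypersurfaceAt G Γ f l μ p) (X Y : U) :
    nullSecondForm G Γ f l p X Y = nullSecondForm G Γ f l p Y X := by
  rw [h.nullSecondForm_eq, h.nullSecondForm_eq, covAlong_fderiv_comm
    (h.contDiffAt_map.of_le (by norm_num)) h.christoffel_symm.self_of_nhds]

/-- The normal is itself tangent, hence null, and `G(l, l) = 0` can be differentiated. -/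
lemma metric_covAlong_normal (h : ParamNullHypersurfaceAt G Γ f l μ p) (X : U) :
    G (f p) (covAlong Γ f l p X) (l p) = 0 := by
  have hl := h.contDiffAt_normal.differentiableAt (by norm_num)
  have h1 := h.fderiv_metric hl hl X
  have h2 : (fun q ↦ G (f q) (l q) (l q)) =ᶠ[𝓝 p] fun _ ↦ 0 := by
    filter_upwards [h.normal, h.normal_eq] with q hq hq'
    conv_lhs => enter [2]; rw [hq']
    exact hq _
  rw [h2.fderiv_eq, h.metric_symm.self_of_nhds (l p)] at h1
  simp only [fderiv_fun_const, Pi.zero_apply, zero_apply] at h1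
  linarith

lemma nullSecondForm_generator_right (h : ParamNullHypersurfaceAt G Γ f l μ p) (X : U) :
    nullSecondForm G Γ f l p X (μ p) = 0 := by
  rw [nullSecondForm, ← h.normal_eq.self_of_nhds, h.metric_covAlong_normal]

lemma nullSecondForm_generator_left (h : ParamNullHypersurfaceAt G Γ f l μ p) (X : U) :
    nullSecondForm G Γ f l p (μ p) X = 0 := by
  rw [h.nullSecondForm_symm, h.nullSecondForm_generator_right]

/-- Torsion-freeness for `μ` and the constant field `X`, whose bracket is `[μ, X] = -∂_X μ`. -/
lemma covAlong_fderiv_generator (h : ParamNullHypersurfaceAt G Γ f l μ p) (X : U) :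
    covAlong Γ f (fun q ↦ fderiv ℝ f q X) p (μ p) =
      covAlong Γ f l p X - fderiv ℝ f p (fderiv ℝ μ p X) := by
  rw [covAlong_fderiv_comm (h.contDiffAt_map.of_le (by norm_num)) h.christoffel_symm.self_of_nhds,
    covAlong_congr (W := l) h.normal_eq, covAlong_clm_apply h.differentiableAt_fderiv
      (h.contDiffAt_generator.differentiableAt (by norm_num))]
  abel

/-- The Lie derivative of the induced metric along the generator is twice the second fundamental
form; the other terms come from the brackets of `μ` with the constant fields. -/
lemma fderiv_induced_metric (h : ParamNullHypersurfaceAt G Γ f l μ p) (X Y : U) :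
    fderiv ℝ (fun q ↦ G (f q) (fderiv ℝ f q X) (fderiv ℝ f q Y)) p (μ p) =
      2 * nullSecondForm G Γ f l p X Y
        - G (f p) (fderiv ℝ f p (fderiv ℝ μ p X)) (fderiv ℝ f p Y)
        - G (f p) (fderiv ℝ f p X) (fderiv ℝ f p (fderiv ℝ μ p Y)) := by
  rw [h.fderiv_metric (W := fun q ↦ fderiv ℝ f q X) (W' := fun q ↦ fderiv ℝ f q Y)
    (h.differentiableAt_fderiv.clm_apply (differentiableAt_const _))
    (h.differentiableAt_fderiv.clm_apply (differentiableAt_const _)), h.covAlong_fderiv_generator,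
    h.covAlong_fderiv_generator, two_mul]
  nth_rw 2 [h.nullSecondForm_symm]
  simp only [nullSecondForm, map_sub, sub_apply]
  rw [h.metric_symm.self_of_nhds (covAlong Γ f l p Y)]
  ring

/-- The evolution equation of the second fundamental form along the generators. -/
lemma fderiv_nullSecondForm (h : ParamNullHypersurfaceAt G Γ f l μ p) {κ : ℝ}
    (hκ : covAlong Γ f l p (μ p) = κ • l p) (X Y : U) :
    fderiv ℝ (fun q ↦ nullSecondForm G Γ f l q X Y) p (μ p) =
      κ * nullSecondForm G Γ f l p X Y - nullSecondForm G Γ f l p (fderiv ℝ μ p X) Y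
        - nullSecondForm G Γ f l p X (fderiv ℝ μ p Y)
        + G (f p) (covAlong Γ f l p X) (covAlong Γ f l p Y)
        - G (f p) (christoffelCurvature Γ (f p) (fderiv ℝ f p X) (l p) (l p))
          (fderiv ℝ f p Y) := by
  have hdf (Z : U) : DifferentiableAt ℝ (fun q ↦ fderiv ℝ f q Z) p :=
    h.differentiableAt_fderiv.clm_apply (differentiableAt_const _)
  have hμ := h.contDiffAt_generator.differentiableAt (by norm_num)
  have h1 := h.fderiv_metric (W := fun q ↦ covAlong Γ f l q X) (W' := fun q ↦ fderiv ℝ f q Y)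
    (h.differentiableAt_covAlong.clm_apply (differentiableAt_const _)) (hdf Y) (μ p)
  -- Differentiate `G(∇_μ l, df Y) = 0`, not `∇_μ l = κ l`: then `κ` is needed only at `p` and no
  -- regularity of it enters.
  have h2 := h.fderiv_metric (W := fun q ↦ covAlong Γ f l q (μ q)) (W' := fun q ↦ fderiv ℝ f q Y)
    (h.differentiableAt_covAlong.clm_apply hμ) (hdf Y) X
  have h3 : (fun q ↦ G (f q) (covAlong Γ f l q (μ q)) (fderiv ℝ f q Y)) =ᶠ[𝓝 p] fun _ ↦ 0 :=
    h.eventually.mono fun q hq ↦ hq.nullSecondForm_generator_left Y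
  rw [h3.fderiv_eq, covAlong_clm_apply h.differentiableAt_covAlong hμ] at h2
  -- Exchanges `∇_μ ∇_X l` in `h1` for `∇_X ∇_μ l` in `h2`, at the cost of the curvature term. Here
  -- `μ` is frozen at `p`.
  have h4 := covAlong_comm (Γ := Γ) (h.contDiffAt_map.of_le (by norm_num))
    (h.contDiffAt_normal.of_le (by norm_num))
    (h.contDiffAt_christoffel.differentiableAt (by norm_num)) X (μ p)
  rw [← h.normal_eq.self_of_nhds] at h4
  rw [← h4]
  simp only [nullSecondForm] at h1 h2 ⊢
  rw [h1, h.covAlong_fderiv_generator]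
  have h5 := h.nullSecondForm_eq X Y
  simp only [nullSecondForm] at h5
  rw [hκ] at h2
  simp only [fderiv_fun_const, Pi.zero_apply, zero_apply, map_add, map_sub, map_smul, add_apply,
    sub_apply, smul_apply, smul_eq_mul] at h2 ⊢
  linear_combination -h2 - κ * h5

end ParamNullHypersurfaceAt

end NullHypersurface

/-! ### The trace condition for pairs that are not orthonormal -/

/-- A trace-free condition for all orthonormal pairs, in terms of an arbitrary pair spanning a
negative definite plane. -/
lemma trace_eq_zero_of_orthonormal {U : Type*} [AddCommGroup U] [Module ℝ U]
    (h K : U →ₗ[ℝ] U →ₗ[ℝ] ℝ) (hs : ∀ X Y, h X Y = h Y X) (Ks : ∀ X Y, K X Y = K Y X)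
    (hK : ∀ e₁ e₂, h e₁ e₁ = -1 → h e₂ e₂ = -1 → h e₁ e₂ = 0 → K e₁ e₁ + K e₂ e₂ = 0)
    {X Y : U} (hX : h X X < 0) (hdet : 0 < h X X * h Y Y - h X Y * h X Y) :
    h Y Y * K X X + h X X * K Y Y - 2 * (h X Y * K X Y) = 0 := by
  set a := h X X with ha
  set b := h X Y with hb
  set c := h Y Y with hc
  have ha0 : a ≠ 0 := hX.ne
  have hd : 0 < -(c - b * b / a) := by
    have : -(c - b * b / a) = (a * c - b * b) / (-a) := by field_simp
    rw [this]
    exact div_pos hdet (by linarith)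
  set s := Real.sqrt (-a) with hs'
  set r := Real.sqrt (-(c - b * b / a)) with hr
  have hs2 : s * s = -a := Real.mul_self_sqrt (by linarith)
  have hr2 : r * r = -(c - b * b / a) := Real.mul_self_sqrt hd.le
  have hs0 : s ≠ 0 := (Real.sqrt_pos.2 (by linarith)).ne'
  have hr0 : r ≠ 0 := (Real.sqrt_pos.2 hd).ne'
  have hYX : h Y X = b := hs Y X
  -- Gram–Schmidt applied to `X`, `Y`. Clearing denominators leaves an expression polynomial in the
  -- entries of `h` and `K`, which can be differentiated for a fixed pair that is orthonormal at one
  -- point only.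
  have key := hK (s⁻¹ • X) (r⁻¹ • (Y - (b / a) • X))
    (by
      simp only [map_smul, LinearMap.smul_apply, smul_eq_mul, ← ha]
      field_simp
      linarith)
    (by
      simp only [map_smul, LinearMap.smul_apply, smul_eq_mul, map_sub, LinearMap.sub_apply,
        ← ha, ← hb, ← hc, hYX]
      have : r⁻¹ * (r⁻¹ * (c - b / a * b) - b / a * (r⁻¹ * (b - b / a * a))) =
          (c - b * b / a) / (r * r) := by
        field_simp
        ring
      rw [this, hr2, div_neg, div_self (by linarith)])
    (by
      simp only [map_smul, LinearMap.smul_apply, smul_eq_mul, map_sub, ← ha, ← hb]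
      field_simp
      ring)
  simp only [map_smul, LinearMap.smul_apply, smul_eq_mul, map_sub, LinearMap.sub_apply,
    Ks Y X] at key
  have h1 : s⁻¹ * s⁻¹ = -1 / a := by
    rw [← mul_inv, hs2]
    field_simp
  have h2 : r⁻¹ * r⁻¹ = -a / (a * c - b * b) := by
    rw [← mul_inv, hr2]
    have : a * c - b * b ≠ 0 := hdet.ne'
    have h3 : -(c - b * b / a) = -(a * c - b * b) / a := by field_simp
    rw [h3, inv_div, div_neg, neg_div]
  replace key : s⁻¹ * s⁻¹ * K X X +
      r⁻¹ * r⁻¹ * (K Y Y - 2 * (b / a) * K X Y + b / a * (b / a) * K X X) = 0 := by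
    linear_combination key
  rw [h1, h2] at key
  have h3 : a * c - b ^ 2 ≠ 0 := by rw [sq]; exact hdet.ne'
  field_simp at key
  have : a * (c * K X X + a * K Y Y - 2 * (b * K X Y)) = 0 := by linear_combination -key
  simpa [ha0] using this

/-! ### Raychaudhuri's equation and the vanishing of the second fundamental form -/

section NullHypersurface

variable {U V : Type*} [NormedAddCommGroup U] [NormedSpace ℝ U]
  [NormedAddCommGroup V] [NormedSpace ℝ V]

namespace ParamNullHypersurfaceAt

variable {G : V → V →L[ℝ] V →L[ℝ] ℝ} {Γ : V → V →L[ℝ] V →L[ℝ] V} {f l : U → V} {μ : U → U} {p : U}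

lemma differentiableAt_induced_metric (h : ParamNullHypersurfaceAt G Γ f l μ p) {W W' : U → V}
    (hW : DifferentiableAt ℝ W p) (hW' : DifferentiableAt ℝ W' p) :
    DifferentiableAt ℝ (fun q ↦ G (f q) (W q) (W' q)) p := by
  have h0 : DifferentiableAt ℝ (fun q ↦ G (f q)) p :=
    DifferentiableAt.comp (G := V →L[ℝ] V →L[ℝ] ℝ) (g := G) p
      (h.contDiffAt_metric.differentiableAt (by norm_num))
      (h.contDiffAt_map.differentiableAt (by norm_num))
  exact (h0.clm_apply hW).clm_apply hW'

/-- If all null normals have vanishing expansion and the Ricci curvature along the null normal is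
nonnegative, then the second fundamental form vanishes. -/
theorem nullSecondForm_eq_zero (h : ParamNullHypersurfaceAt G Γ f l μ p)
    (hexp : ∀ᶠ q in 𝓝 p, ∀ e₁ e₂, G (f q) (fderiv ℝ f q e₁) (fderiv ℝ f q e₁) = -1 →
      G (f q) (fderiv ℝ f q e₂) (fderiv ℝ f q e₂) = -1 →
      G (f q) (fderiv ℝ f q e₁) (fderiv ℝ f q e₂) = 0 →
      nullSecondForm G Γ f l q e₁ e₁ + nullSecondForm G Γ f l q e₂ e₂ = 0)
    (hnormal : ∀ v, (∀ Y, G (f p) v (fderiv ℝ f p Y) = 0) → ∃ κ : ℝ, v = κ • l p)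
    (htangent : ∀ v, G (f p) v (l p) = 0 → ∃ Z, v = fderiv ℝ f p Z)
    {X₁ X₂ : U} (h11 : G (f p) (fderiv ℝ f p X₁) (fderiv ℝ f p X₁) = -1)
    (h22 : G (f p) (fderiv ℝ f p X₂) (fderiv ℝ f p X₂) = -1)
    (h12 : G (f p) (fderiv ℝ f p X₁) (fderiv ℝ f p X₂) = 0)
    (hspan : ∀ X, ∃ a b c : ℝ, X = a • X₁ + b • X₂ + c • μ p)
    (hric : G (f p) (christoffelCurvature Γ (f p) (fderiv ℝ f p X₁) (l p) (l p)) (fderiv ℝ f p X₁)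
      + G (f p) (christoffelCurvature Γ (f p) (fderiv ℝ f p X₂) (l p) (l p)) (fderiv ℝ f p X₂) ≤ 0)
    (X Y : U) : nullSecondForm G Γ f l p X Y = 0 := by
  -- The generators are geodesics up to parametrization: `∇_l l` is orthogonal to the hypersurface,
  -- hence a multiple of `l`.
  obtain ⟨κ, hκ⟩ := hnormal (covAlong Γ f l p (μ p)) fun Y ↦ h.nullSecondForm_generator_left Y
  have hdf (Z : U) : DifferentiableAt ℝ (fun q ↦ fderiv ℝ f q Z) p :=
    h.differentiableAt_fderiv.clm_apply (differentiableAt_const _)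
  have hdh (X Y : U) := h.differentiableAt_induced_metric (hdf X) (hdf Y)
  have hdK (X Y : U) : DifferentiableAt ℝ (fun q ↦ nullSecondForm G Γ f l q X Y) p :=
    h.differentiableAt_induced_metric
      (h.differentiableAt_covAlong.clm_apply (differentiableAt_const _)) (hdf Y)
  have hsymm (X Y : U) : G (f p) (fderiv ℝ f p X) (fderiv ℝ f p Y) =
      G (f p) (fderiv ℝ f p Y) (fderiv ℝ f p X) := h.metric_symm.self_of_nhds _ _
  have h21 := h12
  rw [hsymm] at h21
  -- the traced equation near `p`
  have hev : (fun q ↦ G (f q) (fderiv ℝ f q X₂) (fderiv ℝ f q X₂) * nullSecondForm G Γ f l q X₁ X₁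
      + G (f q) (fderiv ℝ f q X₁) (fderiv ℝ f q X₁) * nullSecondForm G Γ f l q X₂ X₂
      - 2 * (G (f q) (fderiv ℝ f q X₁) (fderiv ℝ f q X₂) * nullSecondForm G Γ f l q X₁ X₂))
      =ᶠ[𝓝 p] fun _ ↦ 0 := by
    have c11 := (hdh X₁ X₁).continuousAt
    have c12 := (hdh X₁ X₂).continuousAt
    have c22 := (hdh X₂ X₂).continuousAt
    -- The fixed vectors `X₁`, `X₂` are orthonormal only at `p`, but they span a negative definite
    -- plane nearby, which is an open condition.
    have e1 := c11.eventually_lt (continuousAt_const (y := (0 : ℝ))) (by rw [h11]; norm_num)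
    have e2 := (continuousAt_const (y := (0 : ℝ))).eventually_lt
      ((c11.mul c22).sub (c12.mul c12)) (by simp [h11, h12, h22])
    filter_upwards [h.eventually, hexp, e1, e2] with q hq hq' h1 h2
    let hq₂ : U →ₗ[ℝ] U →ₗ[ℝ] ℝ := LinearMap.mk₂ ℝ
      (fun X Y ↦ G (f q) (fderiv ℝ f q X) (fderiv ℝ f q Y)) (by simp) (by simp) (by simp) (by simp)
    let Kq : U →ₗ[ℝ] U →ₗ[ℝ] ℝ := LinearMap.mk₂ ℝ
      (fun X Y ↦ nullSecondForm G Γ f l q X Y) (by simp [nullSecondForm]) (by simp [nullSecondForm])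
      (by simp [nullSecondForm]) (by simp [nullSecondForm])
    exact trace_eq_zero_of_orthonormal hq₂ Kq (fun X Y ↦ hq.metric_symm.self_of_nhds _ _)
      (fun X Y ↦ hq.nullSecondForm_symm X Y) hq' h1 h2
  -- The derivative of the trace along the generator `μ p` is computed twice, as zero and by the
  -- product rule.
  have hder := hev.fderiv_eq (𝕜 := ℝ)
  have d1 := (hdh X₂ X₂).hasFDerivAt.fun_mul (hdK X₁ X₁).hasFDerivAt
  have d2 := (hdh X₁ X₁).hasFDerivAt.fun_mul (hdK X₂ X₂).hasFDerivAt
  have d3 := ((hdh X₁ X₂).hasFDerivAt.fun_mul (hdK X₁ X₂).hasFDerivAt).const_mul (2 : ℝ)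
  have hder' := ((d1.fun_add d2).fun_sub d3).fderiv
  have hd := congrArg (fun A : U →L[ℝ] ℝ ↦ A (μ p)) (hder'.symm.trans hder)
  have htr := hexp.self_of_nhds X₁ X₂ h11 h22 h12
  have hKs := h.nullSecondForm_symm
  -- The coefficients of `∂_X μ` enter both through the derivative of the metric and through that of
  -- the second fundamental form; these contributions cancel in the trace.
  obtain ⟨a11, a12, b1, ha1⟩ := hspan (fderiv ℝ μ p X₁)
  obtain ⟨a21, a22, b2, ha2⟩ := hspan (fderiv ℝ μ p X₂)
  have hμ (Y : U) : G (f p) (fderiv ℝ f p (μ p)) (fderiv ℝ f p Y) = 0 := by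
    rw [← h.normal_eq.self_of_nhds]
    exact h.normal.self_of_nhds Y
  have hμ' (Y : U) : G (f p) (fderiv ℝ f p Y) (fderiv ℝ f p (μ p)) = 0 := by
    rw [hsymm, hμ]
  -- `∇_X l` is determined by the second fundamental form
  have hgrad (X : U) : G (f p) (covAlong Γ f l p X) (covAlong Γ f l p X) =
      -(nullSecondForm G Γ f l p X X₁ ^ 2 + nullSecondForm G Γ f l p X X₂ ^ 2) := by
    obtain ⟨Z, hZ⟩ := htangent _ (h.metric_covAlong_normal X)
    obtain ⟨a, b, c, rfl⟩ := hspan Z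
    simp only [nullSecondForm, hZ, map_add, map_smul, add_apply, smul_apply, smul_eq_mul, h11, h12,
      h22, h21, hμ, hμ']
    ring
  have hKlin (a b c : ℝ) (X : U) : nullSecondForm G Γ f l p (a • X₁ + b • X₂ + c • μ p) X =
      a * nullSecondForm G Γ f l p X₁ X + b * nullSecondForm G Γ f l p X₂ X := by
    have := h.nullSecondForm_generator_left X
    simp only [nullSecondForm, map_add, map_smul, add_apply, smul_apply, smul_eq_mul] at this ⊢
    rw [this]
    ring
  have hKlin' (a b c : ℝ) (X : U) : nullSecondForm G Γ f l p X (a • X₁ + b • X₂ + c • μ p) =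
      a * nullSecondForm G Γ f l p X X₁ + b * nullSecondForm G Γ f l p X X₂ := by
    rw [hKs, hKlin, hKs X₁, hKs X₂]
  simp only [add_apply, sub_apply, smul_apply, smul_eq_mul, h.fderiv_induced_metric,
    h.fderiv_nullSecondForm hκ, h11, h12, h22, h21, ha1, ha2, hKlin, hKlin', hgrad, map_add,
    map_smul, hμ, hμ', fderiv_fun_const, Pi.zero_apply, zero_apply] at hd
  rw [hKs X₂ X₁] at hd
  set K11 := nullSecondForm G Γ f l p X₁ X₁
  set K12 := nullSecondForm G Γ f l p X₁ X₂
  set K22 := nullSecondForm G Γ f l p X₂ X₂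
  have hK22 : K22 = -K11 := by linarith
  rw [hK22] at hd
  -- Raychaudhuri: the `κ` term is multiplied by the zero trace, and what remains says that `2 (K11²
  -- + K12²)` equals the curvature sum bounded by `hric`.
  have hsum : K11 ^ 2 + K12 ^ 2 ≤ 0 := by nlinarith
  have hz1 : K11 = 0 := by nlinarith [sq_nonneg K11, sq_nonneg K12]
  have hz2 : K12 = 0 := by nlinarith [sq_nonneg K11, sq_nonneg K12]
  obtain ⟨a, b, c, rfl⟩ := hspan X
  obtain ⟨a', b', c', rfl⟩ := hspan Y
  rw [hKlin, hKlin', hKlin', hKs X₂ X₁]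
  change a * (a' * K11 + b' * K12) + b * (a' * K12 + b' * K22) = 0
  rw [hK22, hz1, hz2]
  ring

end ParamNullHypersurfaceAt

end NullHypersurface

/-! ### Lorentzian linear algebra -/

section LorentzForm

variable {E : Type*} [AddCommGroup E] [Module ℝ E] [TopologicalSpace E]

/-- A symmetric bilinear form which is positive on `t` and negative definite on its orthogonal
complement. -/
structure IsLorentzForm (B : E →L[ℝ] E →L[ℝ] ℝ) (t : E) : Prop where
  symm : ∀ v w, B v w = B w v
  pos : 0 < B t t
  neg : ∀ v, B t v = 0 → v ≠ 0 → B v v < 0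

/-- If `v` is orthogonal to `t` and `B v v ≥ 0`, Cauchy–Schwarz for the spatial parts gives `(t₀² -
|t|²) v₀² ≤ 0`. As `t` is timelike, `v₀ = 0`, and then the spatial part of `v` vanishes too. -/
lemma isLorentzForm_of_basis {B : E →L[ℝ] E →L[ℝ] ℝ} (hB : ∀ v w, B v w = B w v)
    (b : Module.Basis (Fin 4) ℝ E)
    (hb : ∀ i j, B (b i) (b j) = if i = j then (if i = 0 then 1 else -1) else 0)
    {t : E} (ht : 0 < B t t) : IsLorentzForm B t := by
  refine ⟨hB, ht, fun v htv hv ↦ ?_⟩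
  have key (v w : E) : B v w = b.repr v 0 * b.repr w 0 - b.repr v 1 * b.repr w 1
      - b.repr v 2 * b.repr w 2 - b.repr v 3 * b.repr w 3 := by
    conv_lhs => rw [← b.sum_repr v, ← b.sum_repr w]
    simp only [Fin.sum_univ_four, map_add, map_smul, add_apply, smul_apply, hb, smul_eq_mul]
    norm_num [Fin.ext_iff]
    ring
  by_contra hneg
  push Not at hneg
  apply hv
  rw [key] at ht htv hneg
  set t0 := b.repr t 0
  set t1 := b.repr t 1
  set t2 := b.repr t 2
  set t3 := b.repr t 3
  have cs : (t1 * b.repr v 1 + t2 * b.repr v 2 + t3 * b.repr v 3) ^ 2 ≤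
      (t1 ^ 2 + t2 ^ 2 + t3 ^ 2) * (b.repr v 1 ^ 2 + b.repr v 2 ^ 2 + b.repr v 3 ^ 2) := by
    nlinarith [sq_nonneg (t1 * b.repr v 2 - t2 * b.repr v 1),
      sq_nonneg (t1 * b.repr v 3 - t3 * b.repr v 1), sq_nonneg (t2 * b.repr v 3 - t3 * b.repr v 2)]
  have e : t1 * b.repr v 1 + t2 * b.repr v 2 + t3 * b.repr v 3 = t0 * b.repr v 0 := by linarith
  rw [e] at cs
  have h1 : (t1 ^ 2 + t2 ^ 2 + t3 ^ 2) * (b.repr v 1 ^ 2 + b.repr v 2 ^ 2 + b.repr v 3 ^ 2) ≤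
      (t1 ^ 2 + t2 ^ 2 + t3 ^ 2) * b.repr v 0 ^ 2 :=
    mul_le_mul_of_nonneg_left (by linarith) (by positivity)
  have h2 : (t0 * t0 - t1 * t1 - t2 * t2 - t3 * t3) * b.repr v 0 ^ 2 ≤ 0 := by linarith
  have h3 : b.repr v 0 = 0 := by
    by_contra h0
    have : 0 < b.repr v 0 ^ 2 := by positivity
    nlinarith
  rw [h3] at hneg
  have h4 : b.repr v 1 = 0 := by
    nlinarith [sq_nonneg (b.repr v 1), sq_nonneg (b.repr v 2), sq_nonneg (b.repr v 3)]
  have h5 : b.repr v 2 = 0 := by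
    nlinarith [sq_nonneg (b.repr v 1), sq_nonneg (b.repr v 2), sq_nonneg (b.repr v 3)]
  have h6 : b.repr v 3 = 0 := by
    nlinarith [sq_nonneg (b.repr v 1), sq_nonneg (b.repr v 2), sq_nonneg (b.repr v 3)]
  apply b.repr.map_eq_zero_iff.1
  ext i
  fin_cases i <;> simp [h3, h4, h5, h6]

namespace IsLorentzForm

variable {B : E →L[ℝ] E →L[ℝ] ℝ} {t : E}

lemma nonpos (h : IsLorentzForm B t) {v : E} (hv : B t v = 0) : B v v ≤ 0 := by
  by_cases h0 : v = 0
  · simp [h0]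
  · exact (h.neg v hv h0).le

lemma mul_self_le (h : IsLorentzForm B t) {v w : E} (hv : B t v = 0) (hw : B t w = 0) :
    B v w * B v w ≤ B v v * B w w := by
  by_cases h0 : w = 0
  · simp [h0]
  have hw' := h.neg w hw h0
  have := h.nonpos (v := B w w • v - B v w • w) (by simp [hv, hw])
  simp only [map_sub, map_smul, sub_apply, smul_apply, smul_eq_mul, h.symm w v] at this
  nlinarith

/-- Two future pointing causal vectors have nonnegative product. -/
lemma nonneg_of_future (h : IsLorentzForm B t) {v w : E} (hv : 0 ≤ B v v) (hv' : 0 ≤ B t v)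
    (hw : 0 ≤ B w w) (hw' : 0 ≤ B t w) : 0 ≤ B v w := by
  have ht := h.pos
  -- Cauchy–Schwarz for the components orthogonal to `t`, scaled by `B t t` to avoid division.
  -- Causality bounds the right-hand side by `(a * b) ^ 2`, so `N * B v w` lies within `a * b` of `a
  -- * b`.
  have cs := h.mul_self_le (v := B t t • v - B t v • t) (w := B t t • w - B t w • t)
    (by simp; ring) (by simp; ring)
  simp only [map_sub, map_smul, sub_apply, smul_apply, smul_eq_mul, h.symm v t, h.symm w t] at cs
  set N := B t t
  set a := B t v
  set b := B t w
  have cs' : (N * B v w - a * b) ^ 2 ≤ (N * B v v - a ^ 2) * (N * B w w - b ^ 2) := by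
    have : 0 < N ^ 2 := by positivity
    refine le_of_mul_le_mul_left ?_ this
    linarith
  have p1 := h.nonpos (v := N • v - a • t) (by simp [N, a]; ring)
  have p2 := h.nonpos (v := N • w - b • t) (by simp [N, b]; ring)
  simp only [map_sub, map_smul, sub_apply, smul_apply, smul_eq_mul, h.symm v t, h.symm w t] at p1 p2
  have q1 : N * B v v - a ^ 2 ≤ 0 := by
    refine le_of_mul_le_mul_left ?_ ht
    linarith
  have q2 : N * B w w - b ^ 2 ≤ 0 := by
    refine le_of_mul_le_mul_left ?_ ht
    linarith
  have r1 : (N * B v v - a ^ 2) * (N * B w w - b ^ 2) ≤ (a * b) ^ 2 := by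
    have s1 : 0 ≤ N * B v v := by positivity
    have s2 : 0 ≤ N * B w w := by positivity
    nlinarith
  have r2 := sq_le_sq.1 (cs'.trans r1)
  rw [abs_of_nonneg (a := a * b) (by positivity)] at r2
  have := (abs_le.1 r2).1
  by_contra hneg
  push Not at hneg
  nlinarith

lemma apply_ne_zero_of_null (h : IsLorentzForm B t) {l : E} (hl : l ≠ 0) (hn : B l l = 0) :
    B t l ≠ 0 := fun h0 ↦ (h.neg l h0 hl).ne hn

/-- Subtracting a multiple of `l` moves `v` into the orthogonal complement of `t` without changing
`B v v`. -/
lemma neg_of_orthogonal_null (h : IsLorentzForm B t) {l v : E} (hl : l ≠ 0) (hn : B l l = 0)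
    (hv : B l v = 0) (hne : ∀ c : ℝ, v ≠ c • l) : B v v < 0 := by
  have h0 := h.apply_ne_zero_of_null hl hn
  have := h.neg (v - (B t v / B t l) • l) (by simp [h0]) (sub_ne_zero.2 (hne _))
  simpa [hv, hn, h.symm v l] using this

variable {U : Type*} [AddCommGroup U] [Module ℝ U] [FiniteDimensional ℝ U]
  {ι : U →ₗ[ℝ] E} {μ : U}

/-- An orthonormal pair of spacelike tangent vectors of a null hyperplane. -/
lemma exists_orthonormal (h : IsLorentzForm B t) (hι : Function.Injective ι) (hμ : μ ≠ 0)
    (hnull : ∀ X, B (ι μ) (ι X) = 0) (hU : Module.finrank ℝ U = 3) :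
    ∃ X₁ X₂ : U, B (ι X₁) (ι X₁) = -1 ∧ B (ι X₂) (ι X₂) = -1 ∧ B (ι X₁) (ι X₂) = 0 ∧
      ∀ X, ∃ a b c : ℝ, X = a • X₁ + b • X₂ + c • μ := by
  have hl : ι μ ≠ 0 := fun h0 ↦ hμ (hι (h0.trans (map_zero ι).symm))
  have hneg (X : U) (hX : ∀ c : ℝ, X ≠ c • μ) : B (ι X) (ι X) < 0 :=
    h.neg_of_orthogonal_null hl (hnull μ) (hnull X)
      fun c hc ↦ hX c (hι (by simpa using hc))
  have hnorm (X : U) (hX : B (ι X) (ι X) < 0) :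
      ∃ s : ℝ, s ≠ 0 ∧ B (ι (s • X)) (ι (s • X)) = -1 := by
    have hs : 0 < Real.sqrt (-B (ι X) (ι X)) := Real.sqrt_pos.2 (by linarith)
    refine ⟨(Real.sqrt (-B (ι X) (ι X)))⁻¹, (inv_pos.2 hs).ne', ?_⟩
    have h2 := Real.mul_self_sqrt (x := -B (ι X) (ι X)) (by linarith)
    simp only [map_smul, smul_apply, smul_eq_mul]
    rw [← mul_assoc, ← mul_inv, h2]
    have := hX.ne
    field_simp
  have hspan1 : ∃ X : U, X ∉ Submodule.span ℝ ({μ} : Set U) := by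
    by_contra! hall
    have htop : Submodule.span ℝ ({μ} : Set U) = ⊤ := Submodule.eq_top_iff'.2 hall
    have h1 := finrank_span_le_card (R := ℝ) ({μ} : Set U)
    rw [htop, finrank_top, hU] at h1
    simp at h1
  obtain ⟨X, hX⟩ := hspan1
  obtain ⟨s, hs0, hs⟩ := hnorm X (hneg X fun c hc ↦ hX (Submodule.mem_span_singleton.2 ⟨c, hc.symm⟩))
  set X₁ := s • X
  have hspan2 : ∃ X : U, X ∉ Submodule.span ℝ ({X₁, μ} : Set U) := by
    by_contra! hall
    have htop : Submodule.span ℝ ({X₁, μ} : Set U) = ⊤ := Submodule.eq_top_iff'.2 hall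
    classical
    have h1 := finrank_span_le_card (R := ℝ) ({X₁, μ} : Set U)
    rw [htop, finrank_top, hU, Set.toFinset_card] at h1
    have h2 : Fintype.card ({X₁, μ} : Set U) ≤ 2 := by
      rw [← Set.toFinset_card, Set.toFinset_insert, Set.toFinset_singleton]
      exact Finset.card_le_two
    omega
  obtain ⟨Y, hY⟩ := hspan2
  -- The sign is plus because `X₁` has square `-1`: this vector is the part of `Y` orthogonal to
  -- `X₁`.
  have hY' : ∀ c : ℝ, Y + B (ι X₁) (ι Y) • X₁ ≠ c • μ := fun c hc ↦ hY <|
    Submodule.mem_span_pair.2 ⟨-B (ι X₁) (ι Y), c, by rw [← hc]; module⟩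
  obtain ⟨r, hr0, hr⟩ := hnorm _ (hneg _ hY')
  set X₂ := r • (Y + B (ι X₁) (ι Y) • X₁)
  have h12 : B (ι X₁) (ι X₂) = 0 := by simp [X₂, hs]
  refine ⟨X₁, X₂, hs, hr, h12, ?_⟩
  have hnull' (X : U) : B (ι X) (ι μ) = 0 := by rw [h.symm, hnull]
  have h21 : B (ι X₂) (ι X₁) = 0 := by rw [h.symm, h12]
  let F : ℝ × ℝ × ℝ →ₗ[ℝ] U := (LinearMap.toSpanSingleton ℝ U X₁).coprod
    ((LinearMap.toSpanSingleton ℝ U X₂).coprod (LinearMap.toSpanSingleton ℝ U μ))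
  have hF : Function.Injective F := by
    rw [← LinearMap.ker_eq_bot, LinearMap.ker_eq_bot']
    rintro ⟨a, b, c⟩ hZ
    simp only [F, LinearMap.coprod_apply, LinearMap.toSpanSingleton_apply] at hZ
    have ha : a = 0 := by
      have := congrArg (fun Z ↦ B (ι Z) (ι X₁)) hZ
      simpa [-map_smul, LinearMap.map_smul, hs, h21, hnull] using this
    have hb : b = 0 := by
      have := congrArg (fun Z ↦ B (ι Z) (ι X₂)) hZ
      simpa [-map_smul, LinearMap.map_smul, hr, h12, hnull] using this
    simp only [ha, hb, zero_smul, zero_add, smul_eq_zero, hμ, or_false] at hZ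
    simp [ha, hb, hZ]
  have hdim' : Module.finrank ℝ (ℝ × ℝ × ℝ) = Module.finrank ℝ U := by
    rw [Module.finrank_prod, Module.finrank_prod, hU, Module.finrank_self]
  intro X
  obtain ⟨⟨a, b, c⟩, hZ⟩ := (LinearMap.injective_iff_surjective_of_finrank_eq_finrank hdim').1 hF X
  exact ⟨a, b, c, by rw [← hZ]; simp [F, add_assoc]⟩

/-- The trace of an endomorphism which annihilates a null vector and maps into its orthogonal
complement. -/
lemma trace_eq (h : IsLorentzForm B t) {l e₁ e₂ : E} (hl : l ≠ 0) (hll : B l l = 0)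
    (h1 : B e₁ e₁ = -1) (h2 : B e₂ e₂ = -1) (h12 : B e₁ e₂ = 0) (hl1 : B l e₁ = 0)
    (hl2 : B l e₂ = 0) {A : E →ₗ[ℝ] E} (hA : A l = 0) (hA' : ∀ w, B (A w) l = 0)
    (b : Module.Basis (Fin 4) ℝ E) :
    ∑ i, b.repr (A (b i)) i = -(B (A e₁) e₁ + B (A e₂) e₂) := by
  have h0 := h.apply_ne_zero_of_null hl hll
  have h21 : B e₂ e₁ = 0 := by rw [h.symm, h12]
  have h1l : B e₁ l = 0 := by rw [h.symm, hl1]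
  have h2l : B e₂ l = 0 := by rw [h.symm, hl2]
  -- Pairing with `l` isolates the `t` coefficient. For vectors orthogonal to `l` it is zero, so `t`
  -- need not be orthogonal to `e₁`, `e₂` for their coefficients to be read off. The trace is then
  -- taken in the basis `e₁, e₂, l, t`, where `l` and `t` contribute nothing.
  have coef (a₁ a₂ c d : ℝ) (v : E) (hv : a₁ • e₁ + a₂ • e₂ + c • l + d • t = v)
      (hvl : B v l = 0) : d = 0 ∧ a₁ = -B v e₁ ∧ a₂ = -B v e₂ := by
    have hd : d = 0 := by
      rw [← hv] at hvl
      simpa [h1l, h2l, hll, h0] using hvl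
    refine ⟨hd, ?_, ?_⟩
    · rw [← hv]; simp [h1, h21, hl1, hd]
    · rw [← hv]; simp [h12, h2, hl2, hd]
  have hli : LinearIndependent ℝ ![e₁, e₂, l, t] := by
    rw [Fintype.linearIndependent_iff]
    intro a ha
    simp only [Fin.sum_univ_four, Matrix.cons_val] at ha
    obtain ⟨hd, ha₁, ha₂⟩ := coef _ _ _ _ _ ha (by simp)
    simp only [map_zero, zero_apply, neg_zero] at ha₁ ha₂
    simp only [hd, ha₁, ha₂, zero_smul, zero_add, add_zero, smul_eq_zero, hl, or_false] at ha
    intro i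
    fin_cases i <;> assumption
  let c := basisOfLinearIndependentOfCardEqFinrank hli (Module.finrank_eq_card_basis b).symm
  have hc : ⇑c = ![e₁, e₂, l, t] := coe_basisOfLinearIndependentOfCardEqFinrank _ _
  have htr (b : Module.Basis (Fin 4) ℝ E) :
      LinearMap.trace ℝ E A = ∑ i, b.repr (A (b i)) i := by
    rw [LinearMap.trace_eq_matrix_trace ℝ b, Matrix.trace]
    simp [LinearMap.toMatrix_apply]
  rw [← htr, htr c, Fin.sum_univ_four]
  have hrep (w : E) := c.sum_repr (A w)
  simp only [Fin.sum_univ_four, hc, Matrix.cons_val] at hrep ⊢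
  rw [hA, (coef _ _ _ _ _ (hrep t) (hA' t)).1, (coef _ _ _ _ _ (hrep e₁) (hA' e₁)).2.1,
    (coef _ _ _ _ _ (hrep e₂) (hA' e₂)).2.2]
  simp
  ring

variable [FiniteDimensional ℝ E]

/-- The vector `t` is transverse to a null hyperplane, since it is not orthogonal to the null vector
`ι μ`; the rest is a dimension count. -/
lemma exists_eq_smul_add (h : IsLorentzForm B t) (hι : Function.Injective ι) (hμ : μ ≠ 0)
    (hnull : ∀ X, B (ι μ) (ι X) = 0) (hdim : Module.finrank ℝ E = Module.finrank ℝ U + 1) (v : E) :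
    ∃ (a : ℝ) (Z : U), v = a • t + ι Z := by
  have hl : ι μ ≠ 0 := fun h0 ↦ hμ (hι (h0.trans (map_zero ι).symm))
  have h0 := h.apply_ne_zero_of_null hl (hnull μ)
  let F : ℝ × U →ₗ[ℝ] E := (LinearMap.toSpanSingleton ℝ E t).coprod ι
  have hF : Function.Injective F := by
    rw [← LinearMap.ker_eq_bot, LinearMap.ker_eq_bot']
    rintro ⟨a, Z⟩ hZ
    simp only [F, LinearMap.coprod_apply, LinearMap.toSpanSingleton_apply] at hZ
    have h1 := congrArg (B (ι μ)) hZ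
    simp only [map_add, map_smul, hnull, map_zero, smul_eq_mul, add_zero, h.symm _ t] at h1
    have ha : a = 0 := by simpa [h0] using h1
    simp only [ha, zero_smul, zero_add] at hZ
    simp [ha, hι (hZ.trans (map_zero ι).symm)]
  have hdim' : Module.finrank ℝ (ℝ × U) = Module.finrank ℝ E := by
    rw [Module.finrank_prod, hdim, Module.finrank_self, add_comm]
  obtain ⟨⟨a, Z⟩, hZ⟩ := (LinearMap.injective_iff_surjective_of_finrank_eq_finrank hdim').1 hF v
  exact ⟨a, Z, by simpa [F] using hZ.symm⟩

/-- By transversality such a `v` is orthogonal to itself, while the form is negative definite on the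
complement of `t`. -/
lemma eq_zero_of_orthogonal (h : IsLorentzForm B t) (hι : Function.Injective ι) (hμ : μ ≠ 0)
    (hnull : ∀ X, B (ι μ) (ι X) = 0) (hdim : Module.finrank ℝ E = Module.finrank ℝ U + 1) {v : E}
    (hv : ∀ Y, B v (ι Y) = 0) (hv' : B t v = 0) : v = 0 := by
  obtain ⟨a, Z, hZ⟩ := h.exists_eq_smul_add hι hμ hnull hdim v
  by_contra hne
  refine (h.neg v hv' hne).ne ?_
  nth_rw 2 [hZ]
  simp [hv, h.symm v t, hv']

lemma eq_smul_of_orthogonal (h : IsLorentzForm B t) (hι : Function.Injective ι) (hμ : μ ≠ 0)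
    (hnull : ∀ X, B (ι μ) (ι X) = 0) (hdim : Module.finrank ℝ E = Module.finrank ℝ U + 1) {v : E}
    (hv : ∀ Y, B v (ι Y) = 0) : ∃ κ : ℝ, v = κ • ι μ := by
  have hl : ι μ ≠ 0 := fun h0 ↦ hμ (hι (h0.trans (map_zero ι).symm))
  have h0 := h.apply_ne_zero_of_null hl (hnull μ)
  refine ⟨B t v / B t (ι μ), sub_eq_zero.1 ?_⟩
  exact h.eq_zero_of_orthogonal hι hμ hnull hdim (fun Y ↦ by simp [hv, hnull]) (by simp [h0])

/-- This is the criterion for tangency: in a decomposition along `t` and the hyperplane, pairing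
with the null normal kills everything but the `t` part. -/
lemma mem_range_of_orthogonal_null (h : IsLorentzForm B t) (hι : Function.Injective ι) (hμ : μ ≠ 0)
    (hnull : ∀ X, B (ι μ) (ι X) = 0) (hdim : Module.finrank ℝ E = Module.finrank ℝ U + 1) {v : E}
    (hv : B v (ι μ) = 0) : ∃ Z, v = ι Z := by
  have hl : ι μ ≠ 0 := fun h0 ↦ hμ (hι (h0.trans (map_zero ι).symm))
  have h0 := h.apply_ne_zero_of_null hl (hnull μ)
  obtain ⟨a, Z, rfl⟩ := h.exists_eq_smul_add hι hμ hnull hdim v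
  have : a = 0 := by simpa [h.symm (ι Z) (ι μ), hnull, h0] using hv
  exact ⟨Z, by simp [this]⟩

end IsLorentzForm
end LorentzForm

/-! ### Coordinates on the tangent bundle -/

section Coordinates

variable {E : Type*} [NormedAddCommGroup E] [NormedSpace ℝ E]
  {N : Type*} [TopologicalSpace N] [ChartedSpace E N] [IsManifold 𝓘(ℝ, E) ∞ N]
  {E' : Type*} [NormedAddCommGroup E'] [NormedSpace ℝ E']

/-- The components of tangent vectors at `y` in the preferred chart at `x₀`. -/
noncomputable def tangentCoord (x₀ y : N) : TangentSpace 𝓘(ℝ, E) y →L[ℝ] E :=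
  (trivializationAt E (TangentSpace 𝓘(ℝ, E)) x₀).continuousLinearMapAt ℝ y

/-- The tangent vector at `y` with given components in the preferred chart at `x₀`. -/
noncomputable def ofTangentCoord (x₀ y : N) : E →L[ℝ] TangentSpace 𝓘(ℝ, E) y :=
  (trivializationAt E (TangentSpace 𝓘(ℝ, E)) x₀).symmL ℝ y

variable {x₀ y : N}

@[simp]
lemma tangentCoord_ofTangentCoord (hy : y ∈ (chartAt E x₀).source) (a : E) :
    tangentCoord x₀ y (ofTangentCoord x₀ y a) = a :=
  (trivializationAt E (TangentSpace 𝓘(ℝ, E)) x₀).continuousLinearMapAt_symmL (R := ℝ) hy a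

@[simp]
lemma ofTangentCoord_tangentCoord (hy : y ∈ (chartAt E x₀).source) (v : TangentSpace 𝓘(ℝ, E) y) :
    ofTangentCoord x₀ y (tangentCoord x₀ y v) = v :=
  (trivializationAt E (TangentSpace 𝓘(ℝ, E)) x₀).symmL_continuousLinearMapAt (R := ℝ) hy v

lemma trivializationAt_snd (hy : y ∈ (chartAt E x₀).source) (v : TangentSpace 𝓘(ℝ, E) y) :
    (trivializationAt E (TangentSpace 𝓘(ℝ, E)) x₀ ⟨y, v⟩).2 = tangentCoord x₀ y v :=
  congrFun (Bundle.Trivialization.coe_linearMapAt_of_mem (R := ℝ)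
    (trivializationAt E (TangentSpace 𝓘(ℝ, E)) x₀) hy).symm v

omit [NormedSpace ℝ E] [IsManifold 𝓘(ℝ, E) ∞ N] in
lemma eventually_mem_source (hy : y ∈ (chartAt E x₀).source) :
    ∀ᶠ z in 𝓝 y, z ∈ (chartAt E x₀).source :=
  (chartAt E x₀).open_source.mem_nhds hy

lemma tangentCoord_eq_mfderiv (hy : y ∈ (chartAt E x₀).source) :
    tangentCoord x₀ y = mfderiv 𝓘(ℝ, E) 𝓘(ℝ, E) (extChartAt 𝓘(ℝ, E) x₀) y :=
  TangentBundle.continuousLinearMapAt_trivializationAt hy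

lemma mdifferentiableAt_field_iff (hy : y ∈ (chartAt E x₀).source)
    {Y : Π z : N, TangentSpace 𝓘(ℝ, E) z} :
    MDifferentiableAt 𝓘(ℝ, E) (𝓘(ℝ, E).prod 𝓘(ℝ, E)) (T% Y) y ↔
      MDifferentiableAt 𝓘(ℝ, E) 𝓘(ℝ, E) (fun z ↦ tangentCoord x₀ z (Y z)) y := by
  rw [(trivializationAt E (TangentSpace 𝓘(ℝ, E)) x₀).mdifferentiableAt_section_iff 𝓘(ℝ, E) Y hy]
  have : (fun z ↦ (trivializationAt E (TangentSpace 𝓘(ℝ, E)) x₀ ⟨z, Y z⟩).2) =ᶠ[𝓝 y]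
      fun z ↦ tangentCoord x₀ z (Y z) :=
    (eventually_mem_source hy).mono fun z hz ↦ trivializationAt_snd hz _
  exact this.mdifferentiableAt_iff

variable {F : Type*} [NormedAddCommGroup F] [NormedSpace ℝ F] {P : Type*} [TopologicalSpace P]
  [ChartedSpace F P] {ψ : P → N} {q : P}

lemma contMDiffAt_field_along_iff (hy : ψ q ∈ (chartAt E x₀).source) {n : ℕ∞}
    (hψ : ContMDiffAt 𝓘(ℝ, F) 𝓘(ℝ, E) n ψ q)
    {W : Π q : P, TangentSpace 𝓘(ℝ, E) (ψ q)} :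
    ContMDiffAt 𝓘(ℝ, F) (𝓘(ℝ, E).prod 𝓘(ℝ, E)) n
      (fun q ↦ Bundle.TotalSpace.mk' E (E := fun x : N ↦ TangentSpace 𝓘(ℝ, E) x) (ψ q) (W q)) q ↔
      ContMDiffAt 𝓘(ℝ, F) 𝓘(ℝ, E) n (fun q ↦ tangentCoord x₀ (ψ q) (W q)) q := by
  rw [(trivializationAt E (TangentSpace 𝓘(ℝ, E)) x₀).contMDiffAt_iff (IB := 𝓘(ℝ, E)) (by exact hy)]
  have : (fun z ↦ (trivializationAt E (TangentSpace 𝓘(ℝ, E)) x₀ ⟨ψ z, W z⟩).2) =ᶠ[𝓝 q]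
      fun z ↦ tangentCoord x₀ (ψ z) (W z) :=
    (hψ.continuousAt.eventually (eventually_mem_source hy)).mono fun z hz ↦
      trivializationAt_snd hz _
  exact ⟨fun h ↦ h.2.congr_of_eventuallyEq this.symm, fun h ↦ ⟨hψ, h.congr_of_eventuallyEq this⟩⟩

lemma contMDiffAt_field_iff (hy : y ∈ (chartAt E x₀).source) {n : ℕ∞}
    {Y : Π z : N, TangentSpace 𝓘(ℝ, E) z} :
    ContMDiffAt 𝓘(ℝ, E) (𝓘(ℝ, E).prod 𝓘(ℝ, E)) n (T% Y) y ↔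
      ContMDiffAt 𝓘(ℝ, E) 𝓘(ℝ, E) n (fun z ↦ tangentCoord x₀ z (Y z)) y :=
  contMDiffAt_field_along_iff (ψ := id) hy contMDiffAt_id

lemma contMDiffAt_extChartAt_symm (hy : y ∈ (chartAt E x₀).source) {n : ℕ∞} :
    ContMDiffAt 𝓘(ℝ, E) 𝓘(ℝ, E) n (extChartAt 𝓘(ℝ, E) x₀).symm (extChartAt 𝓘(ℝ, E) x₀ y) := by
  have : IsManifold 𝓘(ℝ, E) n N := .of_le (n := ∞) (by exact_mod_cast le_top)
  refine (contMDiffOn_extChartAt_symm x₀).contMDiffAt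
    ((isOpen_extChartAt_target x₀).mem_nhds ((extChartAt 𝓘(ℝ, E) x₀).map_source ?_))
  rwa [extChartAt_source]

lemma contMDiffAt_extChartAt_of_mem (hy : y ∈ (chartAt E x₀).source) {n : ℕ∞} :
    ContMDiffAt 𝓘(ℝ, E) 𝓘(ℝ, E) n (extChartAt 𝓘(ℝ, E) x₀) y := by
  have : IsManifold 𝓘(ℝ, E) n N := .of_le (n := ∞) (by exact_mod_cast le_top)
  exact contMDiffAt_extChartAt' hy

omit [IsManifold 𝓘(ℝ, E) ∞ N] in
lemma extChartAt_symm_apply (hy : y ∈ (chartAt E x₀).source) :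
    (extChartAt 𝓘(ℝ, E) x₀).symm (extChartAt 𝓘(ℝ, E) x₀ y) = y :=
  (extChartAt 𝓘(ℝ, E) x₀).left_inv (by rwa [extChartAt_source])

lemma mdifferentiableAt_comp_symm (hy : y ∈ (chartAt E x₀).source) {w : N → E'}
    (hw : MDifferentiableAt 𝓘(ℝ, E) 𝓘(ℝ, E') w y) :
    DifferentiableAt ℝ (w ∘ (extChartAt 𝓘(ℝ, E) x₀).symm) (extChartAt 𝓘(ℝ, E) x₀ y) := by
  rw [← mdifferentiableAt_iff_differentiableAt]
  exact MDifferentiableAt.comp_of_eq _ hw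
    ((contMDiffAt_extChartAt_symm (n := 1) hy).mdifferentiableAt (by norm_num))
    (extChartAt_symm_apply hy)

lemma mvfderiv_eq_fderiv (hy : y ∈ (chartAt E x₀).source) {w : N → E'}
    (hw : MDifferentiableAt 𝓘(ℝ, E) 𝓘(ℝ, E') w y) (v : TangentSpace 𝓘(ℝ, E) y) :
    mvfderiv 𝓘(ℝ, E) w y v = fderiv ℝ (w ∘ (extChartAt 𝓘(ℝ, E) x₀).symm)
      (extChartAt 𝓘(ℝ, E) x₀ y) (tangentCoord x₀ y v) := by
  have hw' := mdifferentiableAt_comp_symm hy hw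
  have hφ := (contMDiffAt_extChartAt_of_mem (n := 1) hy).mdifferentiableAt (by norm_num)
  have h : w =ᶠ[𝓝 y] (w ∘ (extChartAt 𝓘(ℝ, E) x₀).symm) ∘ extChartAt 𝓘(ℝ, E) x₀ :=
    (eventually_mem_source hy).mono fun z hz ↦ by
      simp only [Function.comp_apply, extChartAt_symm_apply hz]
  have h1 : mfderiv 𝓘(ℝ, E) 𝓘(ℝ, E') w y =
      (mfderiv 𝓘(ℝ, E) 𝓘(ℝ, E') (w ∘ (extChartAt 𝓘(ℝ, E) x₀).symm) (extChartAt 𝓘(ℝ, E) x₀ y)).comp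
        (mfderiv 𝓘(ℝ, E) 𝓘(ℝ, E) (extChartAt 𝓘(ℝ, E) x₀) y) := by
    rw [← mfderiv_comp y hw'.mdifferentiableAt hφ]
    exact h.mfderiv_eq
  rw [tangentCoord_eq_mfderiv hy]
  rw [mfderiv_eq_fderiv] at h1
  exact congrArg (fun A : E →L[ℝ] E' ↦ A v) h1

lemma contMDiffAt_iff_comp_symm (hy : y ∈ (chartAt E x₀).source) {w : N → E'} {n : ℕ∞} :
    ContMDiffAt 𝓘(ℝ, E) 𝓘(ℝ, E') n w y ↔
    ContDiffAt ℝ n (w ∘ (extChartAt 𝓘(ℝ, E) x₀).symm) (extChartAt 𝓘(ℝ, E) x₀ y) := by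
  rw [← contMDiffAt_iff_contDiffAt]
  refine ⟨fun h ↦ ?_, fun h ↦ ?_⟩
  · exact ContMDiffAt.comp_of_eq h (contMDiffAt_extChartAt_symm hy) (extChartAt_symm_apply hy)
  · refine (ContMDiffAt.comp y h (contMDiffAt_extChartAt_of_mem hy)).congr_of_eventuallyEq ?_
    exact (eventually_mem_source hy).mono fun z hz ↦ by
      simp only [Function.comp_apply, extChartAt_symm_apply hz]

/-- The vector field with constant components in the preferred chart at `x₀`. -/
noncomputable def constField (x₀ : N) (a : E) (y : N) : TangentSpace 𝓘(ℝ, E) y :=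
  (trivializationAt E (TangentSpace 𝓘(ℝ, E)) x₀).symm y a

lemma constField_eq (hy : y ∈ (chartAt E x₀).source) (a : E) :
    constField x₀ a y = ofTangentCoord x₀ y a :=
  ((trivializationAt E (TangentSpace 𝓘(ℝ, E)) x₀).symmL_apply (R := ℝ) hy a).symm

@[simp]
lemma tangentCoord_constField (hy : y ∈ (chartAt E x₀).source) (a : E) :
    tangentCoord x₀ y (constField x₀ a y) = a := by
  rw [constField_eq hy, tangentCoord_ofTangentCoord hy]

/-- The extensions used to define the curvature are coordinate fields with constant coefficients, so
their brackets vanish. -/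
lemma extend_eq_constField (v : TangentSpace 𝓘(ℝ, E) x₀) :
    (FiberBundle.extend E v : Π y : N, TangentSpace 𝓘(ℝ, E) y) =
      constField x₀ (tangentCoord x₀ x₀ v) := by
  ext y
  rw [FiberBundle.extend, trivializationAt_snd (mem_chart_source E x₀), constField]

lemma contMDiffAt_constField (hy : y ∈ (chartAt E x₀).source) (a : E) {n : ℕ∞} :
    ContMDiffAt 𝓘(ℝ, E) (𝓘(ℝ, E).prod 𝓘(ℝ, E)) n (T% (constField x₀ a)) y := by
  rw [contMDiffAt_field_iff hy]
  exact contMDiffAt_const.congr_of_eventuallyEq ((eventually_mem_source hy).mono fun z hz ↦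
    tangentCoord_constField hz a)

lemma mdifferentiableAt_constField (hy : y ∈ (chartAt E x₀).source) (a : E) :
    MDifferentiableAt 𝓘(ℝ, E) (𝓘(ℝ, E).prod 𝓘(ℝ, E)) (T% (constField x₀ a)) y :=
  (contMDiffAt_constField (n := 1) hy a).mdifferentiableAt (by norm_num)

/-- These fields are pullbacks under the chart of constant fields on `E`, and pullback commutes with
the bracket. -/
lemma mlieBracket_constField [CompleteSpace E] (hy : y ∈ (chartAt E x₀).source) (a b : E) :
    VectorField.mlieBracket 𝓘(ℝ, E) (constField x₀ a) (constField x₀ b) y = 0 := by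
  let c (a : E) (x : E) : TangentSpace 𝓘(ℝ, E) x := a
  have hpull (a : E) : VectorField.mpullback 𝓘(ℝ, E) 𝓘(ℝ, E) (extChartAt 𝓘(ℝ, E) x₀)
      (c a) =ᶠ[𝓝 y] constField x₀ a := by
    filter_upwards [eventually_mem_source hy] with z hz
    have hinv : (mfderiv 𝓘(ℝ, E) 𝓘(ℝ, E) (extChartAt 𝓘(ℝ, E) x₀) z).IsInvertible :=
      isInvertible_mfderiv_extChartAt (by rwa [extChartAt_source])
    rw [VectorField.mpullback_apply]
    have h1 : mfderiv 𝓘(ℝ, E) 𝓘(ℝ, E) (extChartAt 𝓘(ℝ, E) x₀) z (constField x₀ a z) = a := by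
      rw [← tangentCoord_eq_mfderiv hz]
      exact tangentCoord_constField hz a
    exact hinv.inverse_apply_eq.2 h1.symm
  have hc (a : E) (x : E) : MDifferentiableAt 𝓘(ℝ, E) (𝓘(ℝ, E).prod 𝓘(ℝ, E)) (T% (c a)) x := by
    have := mdifferentiableAt_constField (mem_chart_source E x) a
    refine this.congr_of_eventuallyEq (Filter.Eventually.of_forall fun z ↦ ?_)
    have : constField x a z = c a z := by
      rw [constField_eq (show z ∈ (chartAt E x).source from trivial)]
      simp [ofTangentCoord, c]
      rfl
    exact congrArg (Bundle.TotalSpace.mk' E (E := TangentSpace 𝓘(ℝ, E)) z) this.symm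
  have : IsManifold 𝓘(ℝ, E) (minSmoothness ℝ 3) N :=
    .of_le (n := ∞) (by simp only [minSmoothness_of_isRCLikeNormedField]; exact WithTop.coe_le_coe.2 (le_top : (3 : ℕ∞) ≤ ⊤))
  rw [← (hpull a).mlieBracket_vectorField_eq (hpull b),
    ← VectorField.mpullback_mlieBracket (n := 2) (hc a _) (hc b _) (contMDiffAt_extChartAt_of_mem hy)
    (by simp), VectorField.mpullback_apply, ← VectorField.mlieBracketWithin_univ,
    VectorField.mlieBracketWithin_eq_lieBracketWithin]
  have : VectorField.lieBracketWithin ℝ (c a) (c b) Set.univ (extChartAt 𝓘(ℝ, E) x₀ y) = 0 := by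
    simp [VectorField.lieBracketWithin, c]
  rw [this]
  exact map_zero (ContinuousLinearMap.inverse
    (mfderiv 𝓘(ℝ, E) 𝓘(ℝ, E) (extChartAt 𝓘(ℝ, E) x₀) y))

end Coordinates

/-! ### Connections in coordinates -/

section Christoffel

variable {E : Type*} [NormedAddCommGroup E] [NormedSpace ℝ E]
  {N : Type*} [TopologicalSpace N] [ChartedSpace E N] [IsManifold 𝓘(ℝ, E) ∞ N]

/-- The connection for which the coordinate vector fields of the chart at `x₀` are parallel. -/
noncomputable def chartConnection (x₀ : N) (Y : Π z : N, TangentSpace 𝓘(ℝ, E) z) (y : N) :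
    TangentSpace 𝓘(ℝ, E) y →L[ℝ] TangentSpace 𝓘(ℝ, E) y :=
  ofTangentCoord x₀ y ∘L mvfderiv 𝓘(ℝ, E) (fun z ↦ tangentCoord x₀ z (Y z)) y

/-- The difference of two covariant derivatives is tensorial; comparing `nabla` with this flat one
is what produces the Christoffel symbols. -/
lemma isCovariantDerivativeOn_chartConnection (x₀ : N) :
    IsCovariantDerivativeOn E (chartConnection (E := E) x₀) (chartAt E x₀).source where
  add {σ σ' x} hσ hσ' hx := by
    rw [mdifferentiableAt_field_iff hx] at hσ hσ'
    have : (fun z ↦ tangentCoord x₀ z ((σ + σ') z)) =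
        (fun z ↦ tangentCoord x₀ z (σ z)) + fun z ↦ tangentCoord x₀ z (σ' z) := by
      ext z; simp
    rw [chartConnection, this, mvfderiv_add hσ hσ']
    ext v
    simp [chartConnection]
  leibniz {σ g x} hσ hg hx := by
    rw [mdifferentiableAt_field_iff hx] at hσ
    have : (fun z ↦ tangentCoord x₀ z ((g • σ) z)) = g • fun z ↦ tangentCoord x₀ z (σ z) := by
      ext z; simp
    rw [chartConnection, this, mvfderiv_smul hg hσ]
    ext v
    simp [chartConnection, hx]

variable [FiniteDimensional ℝ E]

/-- The Christoffel symbols of `nabla` in the chart at `x₀`. -/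
noncomputable def christoffel
    (nabla : CovariantDerivative 𝓘(ℝ, E) E (fun x : N ↦ TangentSpace 𝓘(ℝ, E) x)) (x₀ : N) (z : E) :
    E →L[ℝ] E →L[ℝ] E :=
  let y := (extChartAt 𝓘(ℝ, E) x₀).symm z
  ((ofTangentCoord x₀ y).precomp E ∘L (tangentCoord x₀ y).postcomp (TangentSpace 𝓘(ℝ, E) y)) ∘L
    (IsCovariantDerivativeOn.difference (nabla.isCovariantDerivativeOn)
      (isCovariantDerivativeOn_chartConnection x₀) y ∘L ofTangentCoord x₀ y)

variable {nabla : CovariantDerivative 𝓘(ℝ, E) E (fun x : N ↦ TangentSpace 𝓘(ℝ, E) x)} {x₀ y : N}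

lemma tangentCoord_covariantDerivative (hy : y ∈ (chartAt E x₀).source)
    {Y : Π z : N, TangentSpace 𝓘(ℝ, E) z}
    (hY : MDifferentiableAt 𝓘(ℝ, E) (𝓘(ℝ, E).prod 𝓘(ℝ, E)) (T% Y) y) (v : TangentSpace 𝓘(ℝ, E) y) :
    tangentCoord x₀ y (nabla Y y v) = mvfderiv 𝓘(ℝ, E) (fun z ↦ tangentCoord x₀ z (Y z)) y v +
      christoffel nabla x₀ (extChartAt 𝓘(ℝ, E) x₀ y) (tangentCoord x₀ y (Y y))
        (tangentCoord x₀ y v) := by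
  have h := IsCovariantDerivativeOn.difference_apply (nabla.isCovariantDerivativeOn)
    (isCovariantDerivativeOn_chartConnection x₀) hy hY
  simp only [christoffel, ContinuousLinearMap.comp_apply]
  -- The tangent space depends on the base point, so the point obtained by going through the chart
  -- and back is abstracted before it is identified with `y`.
  generalize hy' : (extChartAt 𝓘(ℝ, E) x₀).symm (extChartAt 𝓘(ℝ, E) x₀ y) = y'
  rw [extChartAt_symm_apply hy] at hy'
  subst hy'
  rw [ofTangentCoord_tangentCoord hy, h]
  change _ = _ + tangentCoord x₀ y ((nabla Y y - chartConnection x₀ Y y)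
    (ofTangentCoord x₀ y (tangentCoord x₀ y v)))
  simp [chartConnection, hy]

variable {F : Type*} [NormedAddCommGroup F] [NormedSpace ℝ F] {P : Type*} [TopologicalSpace P]
  [ChartedSpace F P] [IsManifold 𝓘(ℝ, F) ∞ P] {ψ : P → N} {p₀ q : P}

/-- The chart representation of `ψ`. -/
noncomputable def mapCoord (ψ : P → N) (p₀ : P) (x₀ : N) : F → E :=
  extChartAt 𝓘(ℝ, E) x₀ ∘ ψ ∘ (extChartAt 𝓘(ℝ, F) p₀).symm

/-- The components of a vector field along `ψ`, as a function of the coordinates. -/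
noncomputable def fieldCoord (ψ : P → N) (p₀ : P) (x₀ : N)
    (W : Π q : P, TangentSpace 𝓘(ℝ, E) (ψ q)) (u : F) : E :=
  tangentCoord x₀ (ψ ((extChartAt 𝓘(ℝ, F) p₀).symm u)) (W ((extChartAt 𝓘(ℝ, F) p₀).symm u))

omit [IsManifold 𝓘(ℝ, E) ∞ N] [FiniteDimensional ℝ E] [IsManifold 𝓘(ℝ, F) ∞ P] in
lemma mapCoord_apply (hq : q ∈ (chartAt F p₀).source) :
    mapCoord (E := E) ψ p₀ x₀ (extChartAt 𝓘(ℝ, F) p₀ q) = extChartAt 𝓘(ℝ, E) x₀ (ψ q) := by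
  simp only [mapCoord, Function.comp_apply, extChartAt_symm_apply hq]

omit [FiniteDimensional ℝ E] [IsManifold 𝓘(ℝ, F) ∞ P] in
lemma fieldCoord_apply (hq : q ∈ (chartAt F p₀).source)
    (W : Π q : P, TangentSpace 𝓘(ℝ, E) (ψ q)) :
    fieldCoord ψ p₀ x₀ W (extChartAt 𝓘(ℝ, F) p₀ q) = tangentCoord x₀ (ψ q) (W q) := by
  rw [fieldCoord]
  generalize hq' : (extChartAt 𝓘(ℝ, F) p₀).symm (extChartAt 𝓘(ℝ, F) p₀ q) = q'
  rw [extChartAt_symm_apply hq] at hq'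
  subst hq'
  rfl

omit [FiniteDimensional ℝ E] in
lemma fderiv_mapCoord (hq : q ∈ (chartAt F p₀).source) (hx : ψ q ∈ (chartAt E x₀).source)
    (hψ : MDifferentiableAt 𝓘(ℝ, F) 𝓘(ℝ, E) ψ q) (X : TangentSpace 𝓘(ℝ, F) q) :
    fderiv ℝ (mapCoord ψ p₀ x₀) (extChartAt 𝓘(ℝ, F) p₀ q) (tangentCoord p₀ q X) =
      tangentCoord x₀ (ψ q) (mfderiv 𝓘(ℝ, F) 𝓘(ℝ, E) ψ q X) := by
  have hφ : MDifferentiableAt 𝓘(ℝ, E) 𝓘(ℝ, E) (extChartAt 𝓘(ℝ, E) x₀) (ψ q) :=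
    (contMDiffAt_extChartAt_of_mem (n := 1) hx).mdifferentiableAt (by norm_num)
  have := mvfderiv_eq_fderiv hq (hφ.comp q hψ) X
  rw [show mapCoord (E := E) ψ p₀ x₀ = (extChartAt 𝓘(ℝ, E) x₀ ∘ ψ) ∘ (extChartAt 𝓘(ℝ, F) p₀).symm
    from rfl, ← this, tangentCoord_eq_mfderiv hx]
  exact congrArg (fun A ↦ A X) (mfderiv_comp q hφ hψ)

/-- The derivative of a vector field along `ψ` depends only on its values on the image. -/
lemma tangentCoord_covariantDerivative_along (hq : q ∈ (chartAt F p₀).source)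
    (hx : ψ q ∈ (chartAt E x₀).source) (hψ : MDifferentiableAt 𝓘(ℝ, F) 𝓘(ℝ, E) ψ q)
    {Z : Π z : N, TangentSpace 𝓘(ℝ, E) z}
    (hZ : MDifferentiableAt 𝓘(ℝ, E) (𝓘(ℝ, E).prod 𝓘(ℝ, E)) (T% Z) (ψ q))
    {W : Π q : P, TangentSpace 𝓘(ℝ, E) (ψ q)} (hZW : ∀ᶠ q in 𝓝 q, Z (ψ q) = W q)
    (X : TangentSpace 𝓘(ℝ, F) q) :
    tangentCoord x₀ (ψ q) (nabla Z (ψ q) (mfderiv 𝓘(ℝ, F) 𝓘(ℝ, E) ψ q X)) =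
      covAlong (christoffel nabla x₀) (mapCoord ψ p₀ x₀) (fieldCoord ψ p₀ x₀ W)
        (extChartAt 𝓘(ℝ, F) p₀ q) (tangentCoord p₀ q X) := by
  have hZ' := (mdifferentiableAt_field_iff hx).1 hZ
  rw [tangentCoord_covariantDerivative hx hZ, covAlong_apply, mapCoord_apply hq,
    fieldCoord_apply hq, ← hZW.self_of_nhds, fderiv_mapCoord hq hx hψ]
  congr 1
  have h1 : fieldCoord ψ p₀ x₀ W =ᶠ[𝓝 (extChartAt 𝓘(ℝ, F) p₀ q)]
      ((fun z ↦ tangentCoord x₀ z (Z z)) ∘ ψ) ∘ (extChartAt 𝓘(ℝ, F) p₀).symm := by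
    have hc := (contMDiffAt_extChartAt_symm (n := 0) hq).continuousAt
    rw [ContinuousAt, extChartAt_symm_apply hq] at hc
    filter_upwards [hc.eventually hZW] with u hu
    rw [fieldCoord, ← hu]
    rfl
  rw [h1.fderiv_eq, ← mvfderiv_eq_fderiv hq (hZ'.comp q hψ)]
  exact congrArg (fun A ↦ A X) (mfderiv_comp q hZ' hψ).symm

end Christoffel

/-! ### Invertibility by dimension count -/

section FiniteDimensional

variable {E F : Type*} [NormedAddCommGroup E] [NormedSpace ℝ E] [FiniteDimensional ℝ E]
  [NormedAddCommGroup F] [NormedSpace ℝ F] [FiniteDimensional ℝ F]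

lemma finrank_continuousDual : Module.finrank ℝ (E →L[ℝ] ℝ) = Module.finrank ℝ E := by
  rw [← (LinearMap.toContinuousLinearMap (E := E) (F' := ℝ) (𝕜 := ℝ)).finrank_eq]
  exact Subspace.dual_finrank_eq

lemma isInvertible_of_injective {L : E →L[ℝ] F} (hL : Function.Injective L)
    (h : Module.finrank ℝ E = Module.finrank ℝ F) : L.IsInvertible :=
  ⟨(LinearEquiv.ofInjectiveOfFinrankEq (L : E →ₗ[ℝ] F) hL h).toContinuousLinearEquiv, by ext; rfl⟩

end FiniteDimensional

/-! ### Metric connections in coordinates: smooth Christoffel symbols and curvature -/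

section MetricConnection

variable {E : Type*} [NormedAddCommGroup E] [NormedSpace ℝ E] [FiniteDimensional ℝ E]
  {N : Type*} [TopologicalSpace N] [ChartedSpace E N] [IsManifold 𝓘(ℝ, E) ∞ N]

/-- `nabla` is the Levi-Civita connection of the smooth nondegenerate metric `B`. -/
structure IsMetricConnection
    (B : Π x : N, TangentSpace 𝓘(ℝ, E) x →L[ℝ] TangentSpace 𝓘(ℝ, E) x →L[ℝ] ℝ)
    (nabla : CovariantDerivative 𝓘(ℝ, E) E (fun x : N ↦ TangentSpace 𝓘(ℝ, E) x)) : Prop where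
  symm : ∀ x v w, B x v w = B x w v
  nondegenerate : ∀ x v, (∀ w, B x v w = 0) → v = 0
  contMDiff : ContMDiff 𝓘(ℝ, E) (𝓘(ℝ, E).prod 𝓘(ℝ, E →L[ℝ] E →L[ℝ] ℝ)) ∞
    (fun x ↦ Bundle.TotalSpace.mk' (E →L[ℝ] E →L[ℝ] ℝ)
      (E := fun x : N ↦ TangentSpace 𝓘(ℝ, E) x →L[ℝ] TangentSpace 𝓘(ℝ, E) x →L[ℝ] ℝ) x (B x))
  torsion_free : ∀ {X Y : Π x : N, TangentSpace 𝓘(ℝ, E) x} {x : N},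
    MDifferentiableAt 𝓘(ℝ, E) (𝓘(ℝ, E).prod 𝓘(ℝ, E)) (T% X) x →
    MDifferentiableAt 𝓘(ℝ, E) (𝓘(ℝ, E).prod 𝓘(ℝ, E)) (T% Y) x →
      nabla Y x (X x) - nabla X x (Y x) = VectorField.mlieBracket 𝓘(ℝ, E) X Y x
  metric : ∀ (Y Z : Π x : N, TangentSpace 𝓘(ℝ, E) x) (x : N) (v : TangentSpace 𝓘(ℝ, E) x),
    MDifferentiableAt 𝓘(ℝ, E) (𝓘(ℝ, E).prod 𝓘(ℝ, E)) (T% Y) x →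
    MDifferentiableAt 𝓘(ℝ, E) (𝓘(ℝ, E).prod 𝓘(ℝ, E)) (T% Z) x →
      mvfderiv 𝓘(ℝ, E) (fun y : N ↦ B y (Y y) (Z y)) x v =
        B x (nabla Y x v) (Z x) + B x (Y x) (nabla Z x v)

/-- The components of the metric `B` in the chart at `x₀`. -/
noncomputable def metricCoord
    (B : Π x : N, TangentSpace 𝓘(ℝ, E) x →L[ℝ] TangentSpace 𝓘(ℝ, E) x →L[ℝ] ℝ) (x₀ : N) (z : E) :
    E →L[ℝ] E →L[ℝ] ℝ :=
  let y := (extChartAt 𝓘(ℝ, E) x₀).symm z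
  (ofTangentCoord x₀ y).precomp ℝ ∘L B y ∘L ofTangentCoord x₀ y

variable {B : Π x : N, TangentSpace 𝓘(ℝ, E) x →L[ℝ] TangentSpace 𝓘(ℝ, E) x →L[ℝ] ℝ}
  {nabla : CovariantDerivative 𝓘(ℝ, E) E (fun x : N ↦ TangentSpace 𝓘(ℝ, E) x)} {x₀ y : N}

omit [FiniteDimensional ℝ E] in
lemma metricCoord_apply (hy : y ∈ (chartAt E x₀).source) (v w : TangentSpace 𝓘(ℝ, E) y) :
    metricCoord B x₀ (extChartAt 𝓘(ℝ, E) x₀ y) (tangentCoord x₀ y v) (tangentCoord x₀ y w) =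
      B y v w := by
  simp only [metricCoord, ContinuousLinearMap.comp_apply]
  generalize hy' : (extChartAt 𝓘(ℝ, E) x₀).symm (extChartAt 𝓘(ℝ, E) x₀ y) = y'
  rw [extChartAt_symm_apply hy] at hy'
  subst hy'
  change B y (ofTangentCoord x₀ y (tangentCoord x₀ y v))
    (ofTangentCoord x₀ y (tangentCoord x₀ y w)) = _
  rw [ofTangentCoord_tangentCoord hy, ofTangentCoord_tangentCoord hy]

omit [FiniteDimensional ℝ E] in
lemma metricCoord_apply_constField (hy : y ∈ (chartAt E x₀).source) (a b : E) :
    metricCoord B x₀ (extChartAt 𝓘(ℝ, E) x₀ y) a b =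
      B y (constField x₀ a y) (constField x₀ b y) := by
  rw [← metricCoord_apply hy, tangentCoord_constField hy, tangentCoord_constField hy]

omit [IsManifold 𝓘(ℝ, E) ∞ N] [FiniteDimensional ℝ E] in
lemma exists_eq_extChartAt {z : E} (hz : z ∈ (extChartAt 𝓘(ℝ, E) x₀).target) :
    ∃ y ∈ (chartAt E x₀).source, extChartAt 𝓘(ℝ, E) x₀ y = z :=
  ⟨(extChartAt 𝓘(ℝ, E) x₀).symm z, by
    have := (extChartAt 𝓘(ℝ, E) x₀).map_target hz
    rwa [extChartAt_source] at this, (extChartAt 𝓘(ℝ, E) x₀).right_inv hz⟩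

omit [IsManifold 𝓘(ℝ, E) ∞ N] [FiniteDimensional ℝ E] in
lemma extChartAt_mem_target (hy : y ∈ (chartAt E x₀).source) :
    extChartAt 𝓘(ℝ, E) x₀ y ∈ (extChartAt 𝓘(ℝ, E) x₀).target :=
  (extChartAt 𝓘(ℝ, E) x₀).map_source (by rwa [extChartAt_source])

lemma contDiffOn_metricCoord
    (hB : ContMDiff 𝓘(ℝ, E) (𝓘(ℝ, E).prod 𝓘(ℝ, E →L[ℝ] E →L[ℝ] ℝ)) ∞
      (fun x ↦ Bundle.TotalSpace.mk' (E →L[ℝ] E →L[ℝ] ℝ)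
        (E := fun x : N ↦ TangentSpace 𝓘(ℝ, E) x →L[ℝ] TangentSpace 𝓘(ℝ, E) x →L[ℝ] ℝ) x (B x))) :
    ContDiffOn ℝ ∞ (metricCoord B x₀) (extChartAt 𝓘(ℝ, E) x₀).target := by
  rw [contDiffOn_clm_apply]
  intro a
  rw [contDiffOn_clm_apply]
  intro b z hz
  obtain ⟨y, hy, rfl⟩ := exists_eq_extChartAt hz
  refine ContDiffAt.contDiffWithinAt ?_
  have h1 : ContMDiffAt 𝓘(ℝ, E) 𝓘(ℝ, ℝ) ∞
      (fun y ↦ metricCoord B x₀ (extChartAt 𝓘(ℝ, E) x₀ y) a b) y := by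
    have h2 := ContMDiffAt.clm_bundle_apply₂ (F₃ := ℝ) (E₃ := Bundle.Trivial N ℝ)
      (hB y) (contMDiffAt_constField (n := ⊤) hy a)
      (contMDiffAt_constField (n := ⊤) hy b)
    rw [Bundle.contMDiffAt_totalSpace] at h2
    exact h2.2.congr_of_eventuallyEq ((eventually_mem_source hy).mono fun z hz ↦
      metricCoord_apply_constField hz a b)
  rw [contMDiffAt_iff_comp_symm (n := ⊤) hy] at h1
  refine h1.congr_of_eventuallyEq ?_
  filter_upwards [(isOpen_extChartAt_target x₀).mem_nhds (extChartAt_mem_target hy)] with z hz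
  simp only [Function.comp_apply, (extChartAt 𝓘(ℝ, E) x₀).right_inv hz]

lemma tangentCoord_covariantDerivative_constField (hy : y ∈ (chartAt E x₀).source) (a : E)
    (v : TangentSpace 𝓘(ℝ, E) y) :
    tangentCoord x₀ y (nabla (constField x₀ a) y v) =
      christoffel nabla x₀ (extChartAt 𝓘(ℝ, E) x₀ y) a (tangentCoord x₀ y v) := by
  rw [tangentCoord_covariantDerivative hy (mdifferentiableAt_constField hy a),
    tangentCoord_constField hy]
  have : (fun z ↦ tangentCoord x₀ z (constField x₀ a z)) =ᶠ[𝓝 y] fun _ ↦ a :=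
    (eventually_mem_source hy).mono fun z hz ↦ tangentCoord_constField hz a
  have h2 : mvfderiv 𝓘(ℝ, E) (fun z ↦ tangentCoord x₀ z (constField x₀ a z)) y v = 0 := by
    rw [mvfderiv, this.mfderiv_eq]
    exact congrArg (fun A ↦ A v) (mvfderiv_const a)
  rw [h2, zero_add]

namespace IsMetricConnection

lemma christoffel_symm (h : IsMetricConnection B nabla) (hy : y ∈ (chartAt E x₀).source) (a b : E) :
    christoffel nabla x₀ (extChartAt 𝓘(ℝ, E) x₀ y) a b =
      christoffel nabla x₀ (extChartAt 𝓘(ℝ, E) x₀ y) b a := by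
  have := FiniteDimensional.complete ℝ E
  have h1 := h.torsion_free (mdifferentiableAt_constField hy b) (mdifferentiableAt_constField hy a)
  rw [mlieBracket_constField hy, sub_eq_zero] at h1
  have h2 := congrArg (tangentCoord x₀ y) h1
  simpa [tangentCoord_covariantDerivative_constField hy, hy] using h2

lemma fderiv_metricCoord (h : IsMetricConnection B nabla) (hy : y ∈ (chartAt E x₀).source)
    (a b v : E) :
    fderiv ℝ (metricCoord B x₀) (extChartAt 𝓘(ℝ, E) x₀ y) v a b =
      metricCoord B x₀ (extChartAt 𝓘(ℝ, E) x₀ y)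
        (christoffel nabla x₀ (extChartAt 𝓘(ℝ, E) x₀ y) a v) b +
      metricCoord B x₀ (extChartAt 𝓘(ℝ, E) x₀ y) a
        (christoffel nabla x₀ (extChartAt 𝓘(ℝ, E) x₀ y) b v) := by
  have ht := (isOpen_extChartAt_target x₀).mem_nhds (extChartAt_mem_target hy)
  have hd : DifferentiableAt ℝ (metricCoord B x₀) (extChartAt 𝓘(ℝ, E) x₀ y) :=
    ((contDiffOn_metricCoord h.contMDiff).contDiffAt ht).differentiableAt (by norm_num)
  have h1 := h.metric _ _ y (ofTangentCoord x₀ y v) (mdifferentiableAt_constField hy a)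
    (mdifferentiableAt_constField hy b)
  rw [← metricCoord_apply hy, ← metricCoord_apply hy,
    tangentCoord_covariantDerivative_constField hy, tangentCoord_covariantDerivative_constField hy,
    tangentCoord_ofTangentCoord hy, tangentCoord_constField hy, tangentCoord_constField hy] at h1
  rw [← h1]
  have hm : MDifferentiableAt 𝓘(ℝ, E) 𝓘(ℝ, ℝ)
      (fun y ↦ metricCoord B x₀ (extChartAt 𝓘(ℝ, E) x₀ y) a b) y :=
    ((hd.clm_apply (differentiableAt_const a)).clm_apply
      (differentiableAt_const b)).mdifferentiableAt.comp y
      ((contMDiffAt_extChartAt_of_mem (n := 1) hy).mdifferentiableAt (by norm_num))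
  have he : (fun y ↦ B y (constField x₀ a y) (constField x₀ b y)) =ᶠ[𝓝 y]
      fun y ↦ metricCoord B x₀ (extChartAt 𝓘(ℝ, E) x₀ y) a b :=
    (eventually_mem_source hy).mono fun z hz ↦ (metricCoord_apply_constField hz a b).symm
  rw [mvfderiv, he.mfderiv_eq]
  refine Eq.trans ?_ (mvfderiv_eq_fderiv hy hm _).symm
  have he2 : ((fun y ↦ metricCoord B x₀ (extChartAt 𝓘(ℝ, E) x₀ y) a b) ∘
      (extChartAt 𝓘(ℝ, E) x₀).symm) =ᶠ[𝓝 (extChartAt 𝓘(ℝ, E) x₀ y)]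
      fun z ↦ metricCoord B x₀ z a b := by
    filter_upwards [ht] with z hz
    simp only [Function.comp_apply, (extChartAt 𝓘(ℝ, E) x₀).right_inv hz]
  rw [he2.fderiv_eq, tangentCoord_ofTangentCoord hy,
    ((hd.hasFDerivAt.clm_apply (hasFDerivAt_const a _)).clm_apply (hasFDerivAt_const b _)).fderiv]
  simp

lemma isInvertible_metricCoord (h : IsMetricConnection B nabla)
    (hy : y ∈ (chartAt E x₀).source) :
    (metricCoord B x₀ (extChartAt 𝓘(ℝ, E) x₀ y)).IsInvertible := by
  refine isInvertible_of_injective ?_ finrank_continuousDual.symm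
  refine (injective_iff_map_eq_zero _).2 fun a ha ↦ ?_
  have := h.nondegenerate y (constField x₀ a y) fun w ↦ by
    rw [← metricCoord_apply hy, tangentCoord_constField hy, ha]; rfl
  simpa [hy] using congrArg (tangentCoord x₀ y) this

/-- Koszul's formula expresses `G(Γ(a, v), b)` through first derivatives of the metric, and
nondegeneracy lets `G` be inverted. Smoothness of the connection is thus derived from that of the
metric. -/
lemma contDiffOn_christoffel (h : IsMetricConnection B nabla) :
    ContDiffOn ℝ ∞ (christoffel nabla x₀) (extChartAt 𝓘(ℝ, E) x₀).target := by
  have := FiniteDimensional.complete ℝ E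
  have ho := isOpen_extChartAt_target (I := 𝓘(ℝ, E)) x₀
  have hG := contDiffOn_metricCoord (x₀ := x₀) h.contMDiff
  have hc (a b v : E) : ContDiffOn ℝ ∞ (fun z ↦ fderiv ℝ (metricCoord B x₀) z v a b)
      (extChartAt 𝓘(ℝ, E) x₀).target := by
    have h1 : ContDiffOn ℝ ∞ (fun z ↦ metricCoord B x₀ z a b) (extChartAt 𝓘(ℝ, E) x₀).target :=
      (hG.clm_apply contDiffOn_const).clm_apply contDiffOn_const
    refine ((h1.fderiv_of_isOpen (m := ∞) ho (by simp)).clm_apply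
      (contDiffOn_const (c := v))).congr fun z hz ↦ ?_
    have hd : DifferentiableAt ℝ (metricCoord B x₀) z :=
      (hG.contDiffAt (ho.mem_nhds hz)).differentiableAt (by norm_num)
    rw [((hd.hasFDerivAt.clm_apply (hasFDerivAt_const a _)).clm_apply
      (hasFDerivAt_const b _)).fderiv]
    simp
  rw [contDiffOn_clm_apply]
  intro a
  rw [contDiffOn_clm_apply]
  intro v
  have hK : ContDiffOn ℝ ∞ (fun z ↦ metricCoord B x₀ z (christoffel nabla x₀ z a v))
      (extChartAt 𝓘(ℝ, E) x₀).target := by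
    rw [contDiffOn_clm_apply]
    intro b
    refine (((hc a b v).add (hc v b a)).sub (hc a v b) |>.const_smul (1 / 2 : ℝ)).congr
      fun z hz ↦ ?_
    obtain ⟨y, hy, rfl⟩ := exists_eq_extChartAt hz
    have hs (c d : E) : metricCoord B x₀ (extChartAt 𝓘(ℝ, E) x₀ y) c d =
        metricCoord B x₀ (extChartAt 𝓘(ℝ, E) x₀ y) d c := by
      rw [metricCoord_apply_constField hy, h.symm, ← metricCoord_apply_constField hy]
    simp only [h.fderiv_metricCoord hy, smul_eq_mul]
    rw [h.christoffel_symm hy b a, h.christoffel_symm hy v a, h.christoffel_symm hy v b,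
      hs a, hs v, hs _ v]
    ring
  intro z hz
  obtain ⟨y, hy, rfl⟩ := exists_eq_extChartAt hz
  have h1 := h.isInvertible_metricCoord hy
  have h2 : ContDiffWithinAt ℝ ∞ (fun z ↦ (metricCoord B x₀ z).inverse)
      (extChartAt 𝓘(ℝ, E) x₀).target (extChartAt 𝓘(ℝ, E) x₀ y) :=
    ContDiffAt.comp_contDiffWithinAt (g := ContinuousLinearMap.inverse) _
      h1.contDiffAt_map_inverse (hG _ hz)
  refine (h2.clm_apply (hK _ hz)).congr (fun z hz ↦ ?_) (h1.inverse_apply_self _).symm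
  obtain ⟨y, hy, rfl⟩ := exists_eq_extChartAt hz
  exact ((h.isInvertible_metricCoord hy).inverse_apply_self _).symm

lemma tangentCoord_curvature (h : IsMetricConnection B nabla) (hy : y ∈ (chartAt E x₀).source)
    (a b c : E) :
    tangentCoord x₀ y (nabla (fun y ↦ nabla (constField x₀ c) y (constField x₀ b y)) y
        (constField x₀ a y) -
      nabla (fun y ↦ nabla (constField x₀ c) y (constField x₀ a y)) y (constField x₀ b y) -
      nabla (constField x₀ c) y
        (VectorField.mlieBracket 𝓘(ℝ, E) (constField x₀ a) (constField x₀ b) y)) =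
    christoffelCurvature (christoffel nabla x₀) (extChartAt 𝓘(ℝ, E) x₀ y) a b c := by
  have := FiniteDimensional.complete ℝ E
  have hd : DifferentiableAt ℝ (christoffel nabla x₀) (extChartAt 𝓘(ℝ, E) x₀ y) :=
    (h.contDiffOn_christoffel.contDiffAt ((isOpen_extChartAt_target x₀).mem_nhds
      (extChartAt_mem_target hy))).differentiableAt (by norm_num)
  have key (a b : E) : tangentCoord x₀ y (nabla (fun y ↦ nabla (constField x₀ c) y
      (constField x₀ b y)) y (constField x₀ a y)) =
      fderiv ℝ (christoffel nabla x₀) (extChartAt 𝓘(ℝ, E) x₀ y) a c b +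
        christoffel nabla x₀ (extChartAt 𝓘(ℝ, E) x₀ y)
          (christoffel nabla x₀ (extChartAt 𝓘(ℝ, E) x₀ y) c b) a := by
    have he : (fun z ↦ tangentCoord x₀ z (nabla (constField x₀ c) z (constField x₀ b z))) =ᶠ[𝓝 y]
        fun z ↦ christoffel nabla x₀ (extChartAt 𝓘(ℝ, E) x₀ z) c b := by
      filter_upwards [eventually_mem_source hy] with z hz
      rw [tangentCoord_covariantDerivative_constField hz, tangentCoord_constField hz]
    have hm : MDifferentiableAt 𝓘(ℝ, E) 𝓘(ℝ, E)
        (fun y ↦ christoffel nabla x₀ (extChartAt 𝓘(ℝ, E) x₀ y) c b) y :=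
      ((hd.clm_apply (differentiableAt_const c)).clm_apply
        (differentiableAt_const b)).mdifferentiableAt.comp y
        ((contMDiffAt_extChartAt_of_mem (n := 1) hy).mdifferentiableAt (by norm_num))
    have hY := (mdifferentiableAt_field_iff hy).2 (hm.congr_of_eventuallyEq he)
    rw [tangentCoord_covariantDerivative hy hY, tangentCoord_covariantDerivative_constField hy,
      tangentCoord_constField hy b, tangentCoord_constField hy a, mvfderiv, he.mfderiv_eq]
    congr 1
    refine (mvfderiv_eq_fderiv hy hm _).trans ?_
    have he2 : ((fun y ↦ christoffel nabla x₀ (extChartAt 𝓘(ℝ, E) x₀ y) c b) ∘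
        (extChartAt 𝓘(ℝ, E) x₀).symm) =ᶠ[𝓝 (extChartAt 𝓘(ℝ, E) x₀ y)]
        fun z ↦ christoffel nabla x₀ z c b := by
      filter_upwards [(isOpen_extChartAt_target x₀).mem_nhds (extChartAt_mem_target hy)] with z hz
      simp only [Function.comp_apply, (extChartAt 𝓘(ℝ, E) x₀).right_inv hz]
    rw [he2.fderiv_eq, tangentCoord_constField hy,
      ((hd.hasFDerivAt.clm_apply (hasFDerivAt_const c _)).clm_apply
        (hasFDerivAt_const b _)).fderiv]
    simp
  rw [mlieBracket_constField hy, map_zero, sub_zero, map_sub, key, key, christoffelCurvature]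
  abel

end IsMetricConnection

end MetricConnection

/-! ### Immersed hypersurfaces -/

section Immersion

variable {E : Type*} [NormedAddCommGroup E] [NormedSpace ℝ E]
  {N : Type*} [TopologicalSpace N] [ChartedSpace E N] [IsManifold 𝓘(ℝ, E) ∞ N]
  {F : Type*} [NormedAddCommGroup F] [NormedSpace ℝ F]
  {P : Type*} [TopologicalSpace P] [ChartedSpace F P] [IsManifold 𝓘(ℝ, F) ∞ P] {ψ : P → N} {p : P}

omit [IsManifold 𝓘(ℝ, E) ∞ N] [IsManifold 𝓘(ℝ, F) ∞ P] in
/-- An immersion has a smooth local left inverse. -/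
lemma Manifold.IsImmersionAt.exists_local_leftInverse
    (h : Manifold.IsImmersionAt 𝓘(ℝ, F) 𝓘(ℝ, E) ∞ ψ p) :
    ∃ r : N → P, ContMDiffAt 𝓘(ℝ, E) 𝓘(ℝ, F) ∞ r (ψ p) ∧ ∀ᶠ q in 𝓝 p, r (ψ q) = q := by
  -- In adapted charts the immersion is the inclusion `x ↦ (x, 0)`, so projecting to the first
  -- factor inverts it on its image.
  let pr : E →L[ℝ] F := ContinuousLinearMap.fst ℝ F h.complement ∘L
    (h.equiv.symm : E →L[ℝ] F × h.complement)
  have hloc : ∀ q ∈ h.domChart.source, pr (h.codChart (ψ q)) = h.domChart q := by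
    intro q hq
    have hq' : h.domChart q ∈ (h.domChart.extend 𝓘(ℝ, F)).target := by
      simpa using h.domChart.map_source hq
    have h1 := h.writtenInCharts hq'
    simp only [Function.comp_apply, OpenPartialHomeomorph.extend_coe, modelWithCornersSelf_coe,
      OpenPartialHomeomorph.extend_coe_symm, modelWithCornersSelf_coe_symm, id_eq,
      h.domChart.left_inv hq] at h1
    simp [pr, h1]
  refine ⟨h.domChart.symm ∘ pr ∘ h.codChart, ?_, ?_⟩
  · refine ContMDiffAt.comp (I' := 𝓘(ℝ, F)) (ψ p) ?_ (ContMDiffAt.comp (I' := 𝓘(ℝ, E)) (ψ p)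
      pr.contDiff.contDiffAt.contMDiffAt
      (contMDiffAt_of_mem_maximalAtlas h.codChart_mem_maximalAtlas h.mem_codChart_source))
    refine contMDiffAt_symm_of_mem_maximalAtlas h.domChart_mem_maximalAtlas ?_
    rw [Function.comp_apply, hloc p h.mem_domChart_source]
    exact h.domChart.map_source h.mem_domChart_source
  · filter_upwards [h.domChart.open_source.mem_nhds h.mem_domChart_source] with q hq
    simp only [Function.comp_apply, hloc q hq, h.domChart.left_inv hq]

omit [IsManifold 𝓘(ℝ, E) ∞ N] [IsManifold 𝓘(ℝ, F) ∞ P] in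
lemma Manifold.IsImmersionAt.mfderiv_injective
    (h : Manifold.IsImmersionAt 𝓘(ℝ, F) 𝓘(ℝ, E) ∞ ψ p) :
    Function.Injective (mfderiv 𝓘(ℝ, F) 𝓘(ℝ, E) ψ p) := by
  obtain ⟨r, hr, hrψ⟩ := h.exists_local_leftInverse
  have h1 := mfderiv_comp p (hr.mdifferentiableAt (by simp))
    (h.contMDiffAt.mdifferentiableAt (by simp))
  have h2 : (r ∘ ψ) =ᶠ[𝓝 p] id := hrψ
  rw [h2.mfderiv_eq, mfderiv_id] at h1
  intro X Y hXY
  have h3 (X) : mfderiv 𝓘(ℝ, E) 𝓘(ℝ, F) r (ψ p) (mfderiv 𝓘(ℝ, F) 𝓘(ℝ, E) ψ p X) = X :=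
    (congrArg (fun A ↦ A X) h1).symm
  have h4 := congrArg (mfderiv 𝓘(ℝ, E) 𝓘(ℝ, F) r (ψ p)) hXY
  exact (h3 X).symm.trans (h4.trans (h3 Y))

omit [IsManifold 𝓘(ℝ, F) ∞ P] in
/-- A vector field along an immersion extends locally to a vector field which is as regular. -/
lemma Manifold.IsImmersionAt.exists_extension
    (h : Manifold.IsImmersionAt 𝓘(ℝ, F) 𝓘(ℝ, E) ∞ ψ p)
    (W : Π q : P, TangentSpace 𝓘(ℝ, E) (ψ q)) :
    ∃ Z : Π x : N, TangentSpace 𝓘(ℝ, E) x, (∀ᶠ q in 𝓝 p, Z (ψ q) = W q) ∧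
      (MDifferentiableAt 𝓘(ℝ, F) 𝓘(ℝ, E) (fun q ↦ tangentCoord (ψ p) (ψ q) (W q)) p →
        MDifferentiableAt 𝓘(ℝ, E) (𝓘(ℝ, E).prod 𝓘(ℝ, E)) (T% Z) (ψ p)) ∧
      (ContMDiffAt 𝓘(ℝ, F) 𝓘(ℝ, E) ∞ (fun q ↦ tangentCoord (ψ p) (ψ q) (W q)) p →
        ContMDiffAt 𝓘(ℝ, E) (𝓘(ℝ, E).prod 𝓘(ℝ, E)) ∞ (T% Z) (ψ p)) := by
  obtain ⟨r, hr, hrψ⟩ := h.exists_local_leftInverse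
  have hs := mem_chart_source E (ψ p)
  set w : P → E := fun q ↦ tangentCoord (ψ p) (ψ q) (W q) with hw
  have he : (fun y ↦ tangentCoord (ψ p) y (constField (ψ p) (w (r y)) y)) =ᶠ[𝓝 (ψ p)] w ∘ r :=
    (eventually_mem_source hs).mono fun y hy ↦ tangentCoord_constField hy _
  -- The components of `W` are pulled back by the left inverse `r`, so they keep whatever regularity
  -- they have at `p`.
  refine ⟨fun y ↦ constField (ψ p) (w (r y)) y, ?_, fun hd ↦ ?_, fun hd ↦ ?_⟩
  · filter_upwards [hrψ, h.continuousAt.eventually (eventually_mem_source hs)] with q hq hq'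
    rw [hq, constField_eq hq', hw, ofTangentCoord_tangentCoord hq']
  · rw [mdifferentiableAt_field_iff hs]
    refine MDifferentiableAt.congr_of_eventuallyEq ?_ he
    exact hd.comp_of_eq _ (hr.mdifferentiableAt (by simp)) hrψ.self_of_nhds
  · rw [contMDiffAt_field_iff (n := ⊤) hs]
    exact (ContMDiffAt.comp_of_eq hd hr hrψ.self_of_nhds).congr_of_eventuallyEq he

lemma contDiffAt_mapCoord {x₀ : N} {p₀ q : P} (hq : q ∈ (chartAt F p₀).source)
    (hx : ψ q ∈ (chartAt E x₀).source) (hψ : ContMDiff 𝓘(ℝ, F) 𝓘(ℝ, E) ∞ ψ) :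
    ContDiffAt ℝ ∞ (mapCoord (E := E) ψ p₀ x₀) (extChartAt 𝓘(ℝ, F) p₀ q) :=
  (contMDiffAt_iff_comp_symm (E := F) (n := ⊤) hq).1
    (ContMDiffAt.comp (I' := 𝓘(ℝ, E)) q (contMDiffAt_extChartAt_of_mem (n := ⊤) hx) hψ.contMDiffAt)

/-- The coordinates of the push-forward of a vector field. -/
lemma eventually_tangentCoord_mfderiv {x₀ : N} {p₀ q : P} (hq : q ∈ (chartAt F p₀).source)
    (hx : ψ q ∈ (chartAt E x₀).source) (hψ : ContMDiff 𝓘(ℝ, F) 𝓘(ℝ, E) ∞ ψ) :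
    ∀ᶠ q in 𝓝 q, ∀ X : TangentSpace 𝓘(ℝ, F) q,
      tangentCoord x₀ (ψ q) (mfderiv 𝓘(ℝ, F) 𝓘(ℝ, E) ψ q X) =
        fderiv ℝ (mapCoord ψ p₀ x₀) (extChartAt 𝓘(ℝ, F) p₀ q) (tangentCoord p₀ q X) := by
  filter_upwards [eventually_mem_source hq, hψ.continuous.continuousAt.eventually (eventually_mem_source hx)]
    with q h1 h2 X
  exact (fderiv_mapCoord h1 h2 (hψ.contMDiffAt.mdifferentiableAt (by simp)) X).symm

lemma mdifferentiableAt_tangentCoord_mfderiv {x₀ : N} {q : P}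
    (hx : ψ q ∈ (chartAt E x₀).source) (hψ : ContMDiff 𝓘(ℝ, F) 𝓘(ℝ, E) ∞ ψ)
    {Y : Π q : P, TangentSpace 𝓘(ℝ, F) q}
    (hY : MDifferentiableAt 𝓘(ℝ, F) (𝓘(ℝ, F).prod 𝓘(ℝ, F)) (T% Y) q) :
    MDifferentiableAt 𝓘(ℝ, F) 𝓘(ℝ, E)
      (fun q ↦ tangentCoord x₀ (ψ q) (mfderiv 𝓘(ℝ, F) 𝓘(ℝ, E) ψ q (Y q))) q := by
  have hq := mem_chart_source F q
  have h1 := (contDiffAt_mapCoord hq hx hψ).fderiv_right (m := ∞) (by simp)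
  have h2 : MDifferentiableAt 𝓘(ℝ, F) 𝓘(ℝ, F →L[ℝ] E)
      (fun q' ↦ fderiv ℝ (mapCoord ψ q x₀) (extChartAt 𝓘(ℝ, F) q q')) q :=
    (h1.differentiableAt (by simp)).mdifferentiableAt.comp q
      ((contMDiffAt_extChartAt_of_mem (n := 1) hq).mdifferentiableAt (by simp))
  exact (h2.clm_apply ((mdifferentiableAt_field_iff hq).1 hY)).congr_of_eventuallyEq
    ((eventually_tangentCoord_mfderiv hq hx hψ).mono fun q' h ↦ h _)

end Immersion

/-! ### Immersions read in charts -/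

section Charts

variable {E : Type*} [NormedAddCommGroup E] [NormedSpace ℝ E]
  {N : Type*} [TopologicalSpace N] [ChartedSpace E N] [IsManifold 𝓘(ℝ, E) ∞ N]
  {F : Type*} [NormedAddCommGroup F] [NormedSpace ℝ F]
  {P : Type*} [TopologicalSpace P] [ChartedSpace F P] [IsManifold 𝓘(ℝ, F) ∞ P] {ψ : P → N} {p : P}

omit [IsManifold 𝓘(ℝ, F) ∞ P] in
lemma eventually_exists_extChartAt_eq {p₀ : P} (hp : p ∈ (chartAt F p₀).source) {Q : P → Prop}
    (hQ : ∀ᶠ q in 𝓝 p, Q q) :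
    ∀ᶠ u in 𝓝 (extChartAt 𝓘(ℝ, F) p₀ p), ∃ q ∈ (chartAt F p₀).source,
      extChartAt 𝓘(ℝ, F) p₀ q = u ∧ Q q := by
  have ht := (isOpen_extChartAt_target (I := 𝓘(ℝ, F)) p₀).mem_nhds (extChartAt_mem_target hp)
  have hc : Filter.Tendsto (extChartAt 𝓘(ℝ, F) p₀).symm (𝓝 (extChartAt 𝓘(ℝ, F) p₀ p)) (𝓝 p) := by
    have := continuousAt_extChartAt_symm'' (extChartAt_mem_target hp)
    rwa [ContinuousAt, extChartAt_symm_apply hp] at this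
  filter_upwards [ht, hc.eventually hQ] with u hu hq
  refine ⟨_, ?_, (extChartAt 𝓘(ℝ, F) p₀).right_inv hu, hq⟩
  simpa using (extChartAt 𝓘(ℝ, F) p₀).map_target hu

/-- In the charts, the differential of an immersion has a smooth left inverse. -/
lemma Manifold.IsImmersionAt.exists_leftInverse_fderiv
    (h : Manifold.IsImmersionAt 𝓘(ℝ, F) 𝓘(ℝ, E) ∞ ψ p) :
    ∃ S : F → E →L[ℝ] F, ContDiffAt ℝ ∞ S (extChartAt 𝓘(ℝ, F) p p) ∧
      ∀ᶠ u in 𝓝 (extChartAt 𝓘(ℝ, F) p p), ∀ X, S u (fderiv ℝ (mapCoord ψ p (ψ p)) u X) = X := by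
  obtain ⟨r, hr, hrψ⟩ := h.exists_local_leftInverse
  have hp := mem_chart_source F p
  have hx := mem_chart_source E (ψ p)
  have hrp := hrψ.self_of_nhds
  have hf : ContDiffAt ℝ ∞ (mapCoord (E := E) ψ p (ψ p)) (extChartAt 𝓘(ℝ, F) p p) :=
    (contMDiffAt_iff_comp_symm (E := F) (n := ⊤) hp).1
      (ContMDiffAt.comp (I' := 𝓘(ℝ, E)) p (contMDiffAt_extChartAt_of_mem (n := ⊤) hx) h.contMDiffAt)
  have hR : ContDiffAt ℝ ∞ (mapCoord (E := F) r (ψ p) p)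
      (mapCoord (E := E) ψ p (ψ p) (extChartAt 𝓘(ℝ, F) p p)) := by
    rw [mapCoord_apply hp]
    exact (contMDiffAt_iff_comp_symm (E := E) (n := ⊤) hx).1
      (ContMDiffAt.comp (I' := 𝓘(ℝ, F)) (ψ p)
        (contMDiffAt_extChartAt_of_mem (n := ⊤) (by rw [hrp]; exact hp)) hr)
  have hRf : mapCoord (E := F) r (ψ p) p ∘ mapCoord (E := E) ψ p (ψ p)
      =ᶠ[𝓝 (extChartAt 𝓘(ℝ, F) p p)] id := by
    filter_upwards [eventually_exists_extChartAt_eq hp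
      (hrψ.and (h.continuousAt.eventually (eventually_mem_source hx)))] with u
    rintro ⟨q, hq, rfl, hq1, hq2⟩
    rw [Function.comp_apply, mapCoord_apply hq, mapCoord_apply hq2, hq1, id]
  -- The left inverse of `df` is the derivative of the local left inverse `r`, evaluated along `f`.
  refine ⟨fun u ↦ fderiv ℝ (mapCoord r (ψ p) p) (mapCoord ψ p (ψ p) u),
    ContDiffAt.comp (g := fderiv ℝ (mapCoord r (ψ p) p)) _ (hR.fderiv_right (by simp)) hf, ?_⟩
  have h1 (n : ℕ) : (n : ℕ∞ω) ≤ ∞ := by exact_mod_cast le_top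
  filter_upwards [hRf.eventuallyEq_nhds, (hf.of_le (h1 1)).eventually (by simp),
    hf.continuousAt.eventually ((hR.of_le (h1 1)).eventually (by simp))] with u h2 h3 h4 X
  have h5 := fderiv_comp u (h4.differentiableAt (by simp)) (h3.differentiableAt (by simp))
  rw [h2.fderiv_eq, fderiv_id] at h5
  exact (congrArg (fun A ↦ A X) h5).symm

end Charts

instance TangentSpace.instFiniteDimensional {E : Type*} [NormedAddCommGroup E] [NormedSpace ℝ E]
    [FiniteDimensional ℝ E] {N : Type*} [TopologicalSpace N] [ChartedSpace E N] (x : N) :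
    FiniteDimensional ℝ (TangentSpace 𝓘(ℝ, E) x) :=
  inferInstanceAs (FiniteDimensional ℝ E)

/-! ### The spacetime metric as a Lorentz form -/

section Spacetime

variable {M : Type*} [TopologicalSpace M] [ChartedSpace E4 M] [IsManifold (𝓡 4) ∞ M]
  {g : LorentzianMetric M}

lemma TimeOrientation.isLorentzForm (τ : TimeOrientation g) (x : M) :
    IsLorentzForm (g.inner x) (τ.field x) := by
  obtain ⟨b, hb⟩ := g.signature x
  exact isLorentzForm_of_basis (g.symm x) b hb (τ.timelike x)

lemma LorentzianMetric.IsLeviCivita.isMetricConnection {nabla : AffineConnection M}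
    (h : g.IsLeviCivita nabla) (τ : TimeOrientation g) : IsMetricConnection g.inner nabla where
  symm := g.symm
  nondegenerate x v hv := by
    by_contra h0
    exact ((τ.isLorentzForm x).neg v (by rw [g.symm, hv]) h0).ne (hv v)
  contMDiff := g.contMDiff
  torsion_free := (nabla.torsion_eq_zero_iff).1 h.torsion_free
  metric := h.metric

end Spacetime

/-! ### The normalized null normal and its smoothness -/

section NullNormal

variable {M : Type*} [TopologicalSpace M] [ChartedSpace E4 M] [IsManifold (𝓡 4) ∞ M]
  {H : Type*} [TopologicalSpace H] [ChartedSpace E3 H] [IsManifold (𝓡 3) ∞ H]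
  {g : LorentzianMetric M} {τ : TimeOrientation g} {ψ : H → M}

-- A nonzero null vector is never orthogonal to the time orientation, so it can be rescaled to have
-- product `1` with it. This fixes both scale and time direction, so that pointwise choices fit
-- together into one global normal.
omit [IsManifold (𝓡 3) ∞ H] in
lemma IsNullHypersurface.exists_generator (h : IsNullHypersurface g ψ) (τ : TimeOrientation g)
    (hψ : ∀ p, Function.Injective (pushforward ψ p)) (p : H) :
    ∃ μ : TangentSpace (𝓡 3) p, μ ≠ 0 ∧ g.inner (ψ p) (τ.field (ψ p)) (pushforward ψ p μ) = 1 ∧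
      ∀ X, g.inner (ψ p) (pushforward ψ p μ) (pushforward ψ p X) = 0 := by
  obtain ⟨μ, hμ, hn⟩ := h p
  have hl : pushforward ψ p μ ≠ 0 := fun h0 ↦ hμ (hψ p (h0.trans (map_zero _).symm))
  have h0 := (τ.isLorentzForm (ψ p)).apply_ne_zero_of_null hl (hn μ)
  refine ⟨(g.inner (ψ p) (τ.field (ψ p)) (pushforward ψ p μ))⁻¹ • μ, ?_, ?_, fun X ↦ ?_⟩
  · exact smul_ne_zero (inv_ne_zero h0) hμ
  · rw [map_smul, map_smul, smul_eq_mul, inv_mul_cancel₀ h0]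
  · rw [map_smul, map_smul, smul_apply, hn, smul_zero]

/-- The normalized null normal of a null hypersurface is smooth. -/
lemma contMDiff_of_normal (τ : TimeOrientation g)
    (hψ : Manifold.IsSmoothEmbedding (𝓡 3) (𝓡 4) ∞ ψ) {μ : Π p : H, TangentSpace (𝓡 3) p}
    (hτ : ∀ p, g.inner (ψ p) (τ.field (ψ p)) (pushforward ψ p (μ p)) = 1)
    (hn : ∀ p X, g.inner (ψ p) (pushforward ψ p (μ p)) (pushforward ψ p X) = 0) :
    ContMDiff (𝓡 3) ((𝓡 4).prod 𝓘(ℝ, E4)) ∞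
      (fun p ↦ Bundle.TotalSpace.mk' E4 (E := fun x : M ↦ TangentSpace (𝓡 4) x) (ψ p)
        (pushforward ψ p (μ p))) := by
  intro p
  have hp := mem_chart_source E3 p
  have hx := mem_chart_source E4 (ψ p)
  have hinj (q) := (hψ.isImmersion.isImmersionAt q).mfderiv_injective
  have hdim : Module.finrank ℝ E4 = Module.finrank ℝ ((E3 →L[ℝ] ℝ) × ℝ) := by
    rw [Module.finrank_prod, finrank_continuousDual]; simp
  let f := mapCoord (E := E4) (F := E3) ψ p (ψ p)
  let G := metricCoord g.inner (ψ p)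
  let t (u : E3) := tangentCoord (ψ p) ((extChartAt (𝓡 4) (ψ p)).symm (f u))
    (τ.field ((extChartAt (𝓡 4) (ψ p)).symm (f u)))
  let l := fieldCoord (E := E4) (F := E3) ψ p (ψ p) (fun q ↦ pushforward ψ q (μ q))
  -- Normality and normalization together form the linear system `L u w = (0, 1)`. It depends
  -- smoothly on `u` and is invertible (injective, with `4 = 3 + 1`), so its solution, the normal,
  -- is smooth.
  let L (u : E3) : E4 →L[ℝ] (E3 →L[ℝ] ℝ) × ℝ :=
    ContinuousLinearMap.inl ℝ _ _ ∘L
      ((ContinuousLinearMap.compL ℝ E3 E4 ℝ).flip (fderiv ℝ f u) ∘L G (f u)) +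
    ContinuousLinearMap.inr ℝ _ _ ∘L G (f u) (t u)
  have hf : ContDiffAt ℝ ∞ f (extChartAt (𝓡 3) p p) := contDiffAt_mapCoord hp hx hψ.contMDiff
  have hG : ContDiffAt ℝ ∞ G (f (extChartAt (𝓡 3) p p)) := by
    refine (contDiffOn_metricCoord g.contMDiff).contDiffAt
      ((isOpen_extChartAt_target (ψ p)).mem_nhds ?_)
    rw [show f _ = _ from mapCoord_apply hp]
    exact extChartAt_mem_target hx
  have ht : ContDiffAt ℝ ∞ t (extChartAt (𝓡 3) p p) := by
    have h1 := (contMDiffAt_iff_comp_symm (n := ⊤) hx).1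
      ((contMDiffAt_field_iff (n := ⊤) hx).1 (τ.contMDiff (ψ p)))
    rw [← show f _ = _ from mapCoord_apply hp] at h1
    exact ContDiffAt.comp _ h1 hf
  have hGf : ContDiffAt ℝ ∞ (fun u ↦ G (f u)) (extChartAt (𝓡 3) p p) :=
    ContDiffAt.comp (g := G) _ hG hf
  have hL : ContDiffAt ℝ ∞ L (extChartAt (𝓡 3) p p) := by
    refine ContDiffAt.add (contDiffAt_const.clm_comp (ContDiffAt.clm_comp ?_ hGf))
      (contDiffAt_const.clm_comp (hGf.clm_apply ht))
    exact contDiffAt_const.clm_apply (hf.fderiv_right (by simp))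
  have key : ∀ᶠ u in 𝓝 (extChartAt (𝓡 3) p p), (L u).IsInvertible ∧ L u (l u) = (0, 1) := by
    filter_upwards [eventually_exists_extChartAt_eq hp
      (hψ.contMDiff.continuous.continuousAt.eventually (eventually_mem_source hx))] with u
    rintro ⟨q, hq, rfl, hxq⟩
    have hfq : f (extChartAt (𝓡 3) p q) = extChartAt (𝓡 4) (ψ p) (ψ q) := mapCoord_apply hq
    have htq : t (extChartAt (𝓡 3) p q) = tangentCoord (ψ p) (ψ q) (τ.field (ψ q)) :=
      congrArg (fun y ↦ tangentCoord (ψ p) y (τ.field y))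
        ((congrArg (extChartAt (𝓡 4) (ψ p)).symm hfq).trans (extChartAt_symm_apply hxq))
    have hL1 (w : TangentSpace (𝓡 4) (ψ q)) (X : TangentSpace (𝓡 3) q) :
        (L (extChartAt (𝓡 3) p q) (tangentCoord (ψ p) (ψ q) w)).1 (tangentCoord p q X) =
          g.inner (ψ q) w (pushforward ψ q X) := by
      rw [← metricCoord_apply (B := g.inner) hxq, ← fderiv_mapCoord hq hxq
        (hψ.contMDiff.contMDiffAt.mdifferentiableAt (by simp)), ← hfq]
      simp [L]
      rfl
    have hL2 (w : TangentSpace (𝓡 4) (ψ q)) :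
        (L (extChartAt (𝓡 3) p q) (tangentCoord (ψ p) (ψ q) w)).2 =
          g.inner (ψ q) (τ.field (ψ q)) w := by
      rw [← metricCoord_apply (B := g.inner) hxq, ← htq, ← hfq]
      simp [L]
      rfl
    refine ⟨isInvertible_of_injective ((injective_iff_map_eq_zero _).2 fun v hv ↦ ?_) hdim, ?_⟩
    · have hμ : μ q ≠ 0 := fun h0 ↦ by simpa [h0] using hτ q
      have hw := (τ.isLorentzForm (ψ q)).eq_zero_of_orthogonal
        (ι := (pushforward ψ q : TangentSpace (𝓡 3) q →ₗ[ℝ] TangentSpace (𝓡 4) (ψ q)))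
        (v := ofTangentCoord (ψ p) (ψ q) v) (hinj q) hμ (hn q)
        (show Module.finrank ℝ E4 = Module.finrank ℝ E3 + 1 by simp)
        (fun Y ↦ by
          change g.inner (ψ q) _ (pushforward ψ q Y) = 0
          rw [← hL1, tangentCoord_ofTangentCoord hxq, hv]; rfl)
        (by rw [← hL2, tangentCoord_ofTangentCoord hxq, hv]; rfl)
      rw [← tangentCoord_ofTangentCoord hxq v, hw, map_zero]
    · have hlq : l (extChartAt (𝓡 3) p q) =
          tangentCoord (ψ p) (ψ q) (pushforward ψ q (μ q)) := fieldCoord_apply hq _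
      rw [hlq]
      refine Prod.ext (ContinuousLinearMap.ext fun X ↦ ?_) ((hL2 _).trans (hτ q))
      rw [← tangentCoord_ofTangentCoord hq X, hL1, hn]
      rfl
  have hl : ContDiffAt ℝ ∞ l (extChartAt (𝓡 3) p p) := by
    have h1 : ContDiffAt ℝ ∞ (fun u ↦ (L u).inverse (0, 1)) (extChartAt (𝓡 3) p p) :=
      (ContDiffAt.comp (g := ContinuousLinearMap.inverse) _
        key.self_of_nhds.1.contDiffAt_map_inverse hL).clm_apply contDiffAt_const
    refine h1.congr_of_eventuallyEq (key.mono fun u hu ↦ ?_)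
    change l u = (L u).inverse (0, 1)
    rw [← hu.2, hu.1.inverse_apply_self]
  have := (contMDiffAt_iff_comp_symm (n := ⊤) hp).2 (show ContDiffAt ℝ ∞
    ((fun q ↦ tangentCoord (ψ p) (ψ q) (pushforward ψ q (μ q))) ∘ (extChartAt (𝓡 3) p).symm) _
    from hl)
  exact (contMDiffAt_field_along_iff (n := ⊤) hx hψ.contMDiff.contMDiffAt).2 this

end NullNormal

/-! ### Skewness and linearity of the curvature -/

section Curvature

variable {V : Type*} [NormedAddCommGroup V] [NormedSpace ℝ V]
  {Γ : V → V →L[ℝ] V →L[ℝ] V} {G : V → V →L[ℝ] V →L[ℝ] ℝ} {z : V}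

/-- The curvature of a metric connection is skew. -/
lemma metric_christoffelCurvature_self (hG : ContDiffAt ℝ 2 G z) (hΓ : DifferentiableAt ℝ Γ z)
    (hsymm : ∀ᶠ z in 𝓝 z, ∀ a b, G z a b = G z b a)
    (hcompat : ∀ᶠ z in 𝓝 z, ∀ a b v,
      fderiv ℝ G z v a b = G z (Γ z a v) b + G z a (Γ z b v)) (u v w : V) :
    G z (christoffelCurvature Γ z u v w) w = 0 := by
  -- By compatibility the derivative of `φ` along `v` is `2 G(Γ(w, v), w)`. Symmetry of the second
  -- derivative of `φ` in `u`, `v` is then the claim.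
  let φ (z : V) : ℝ := G z w w
  have hφ : ContDiffAt ℝ 2 φ z := (hG.clm_apply contDiffAt_const).clm_apply contDiffAt_const
  have hφ' : DifferentiableAt ℝ (fderiv ℝ φ) z :=
    (hφ.fderiv_right (m := 1) (by norm_num)).differentiableAt (by norm_num)
  have hG1 : DifferentiableAt ℝ G z := hG.differentiableAt (by norm_num)
  have hd : ∀ᶠ z in 𝓝 z, DifferentiableAt ℝ G z :=
    (hG.eventually (by simp)).mono fun z h ↦ h.differentiableAt (by norm_num)
  have h1 (v : V) : (fun z ↦ fderiv ℝ φ z v) =ᶠ[𝓝 z] fun z ↦ (2 : ℝ) * G z (Γ z w v) w := by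
    filter_upwards [hd, hsymm, hcompat] with z h2 h3 h4
    rw [((h2.hasFDerivAt.clm_apply (hasFDerivAt_const w z)).clm_apply
      (hasFDerivAt_const w z)).fderiv]
    simp [h4, h3 w, two_mul]
  have h2 (u v : V) : fderiv ℝ (fderiv ℝ φ) z u v =
      2 * (fderiv ℝ G z u (Γ z w v) w + G z (fderiv ℝ Γ z u w v) w) := by
    have h3 : fderiv ℝ (fun z ↦ fderiv ℝ φ z v) z u = fderiv ℝ (fderiv ℝ φ) z u v := by
      rw [(hφ'.hasFDerivAt.clm_apply (hasFDerivAt_const v z)).fderiv]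
      simp
    have h4 := ((hG1.hasFDerivAt.clm_apply ((hΓ.hasFDerivAt.clm_apply
      (hasFDerivAt_const w z)).clm_apply (hasFDerivAt_const v z))).clm_apply
        (hasFDerivAt_const w z)).const_mul (2 : ℝ)
    rw [← h3, (h1 v).fderiv_eq, h4.fderiv]
    simp
    ring
  have hs : IsSymmSndFDerivAt ℝ φ z := hφ.isSymmSndFDerivAt (by simp)
  have h3 := hs.eq u v
  have h4 := hsymm.self_of_nhds
  rw [h2, h2, hcompat.self_of_nhds, hcompat.self_of_nhds, h4 (Γ z w u)] at h3
  simp only [christoffelCurvature, map_add, map_sub, add_apply, sub_apply]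
  linarith

/-- The curvature as a linear map in its first argument. -/
noncomputable def christoffelCurvatureHom (Γ : V → V →L[ℝ] V →L[ℝ] V) (z v w : V) : V →ₗ[ℝ] V :=
  IsLinearMap.mk' (fun u ↦ christoffelCurvature Γ z u v w)
    { map_add := fun a b ↦ by simp only [christoffelCurvature, map_add, add_apply]; abel
      map_smul := fun c a ↦ by
        simp only [christoffelCurvature, map_smul, smul_apply]; module }

end Curvature

/-! ### The Ricci tensor on a null vector -/

section Horizon

variable {M : Type*} [TopologicalSpace M] [ChartedSpace E4 M] [IsManifold (𝓡 4) ∞ M]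
  {g : LorentzianMetric M} {τ : TimeOrientation g} {nabla : AffineConnection M}

lemma LorentzianMetric.IsLeviCivita.curvature_eq (h : g.IsLeviCivita nabla) (τ : TimeOrientation g)
    (x : M) (u v w : TangentSpace (𝓡 4) x) :
    nabla.curvature x u v w = ofTangentCoord x x (christoffelCurvature (christoffel nabla x)
      (extChartAt (𝓡 4) x x) (tangentCoord x x u) (tangentCoord x x v) (tangentCoord x x w)) := by
  have hx := mem_chart_source E4 x
  rw [← (h.isMetricConnection τ).tangentCoord_curvature hx, ofTangentCoord_tangentCoord hx,
    AffineConnection.curvature]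
  simp only [extend_eq_constField, constField_eq hx, ofTangentCoord_tangentCoord hx]

/-- The endomorphism `w ↦ R(w, l) l` kills `l` by antisymmetry and maps into the complement of `l`
by skewness of the curvature, so only the spacelike directions contribute to its trace. Its
linearity is visible only in the Christoffel expression. -/
lemma LorentzianMetric.IsLeviCivita.ricci_null (h : g.IsLeviCivita nabla) (τ : TimeOrientation g)
    {x : M} {l e₁ e₂ : TangentSpace (𝓡 4) x} (hl : l ≠ 0) (hll : g.inner x l l = 0)
    (h1 : g.inner x e₁ e₁ = -1) (h2 : g.inner x e₂ e₂ = -1) (h12 : g.inner x e₁ e₂ = 0)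
    (hl1 : g.inner x l e₁ = 0) (hl2 : g.inner x l e₂ = 0) :
    g.ricci nabla x l l =
      -(g.inner x (nabla.curvature x e₁ l l) e₁ + g.inner x (nabla.curvature x e₂ l l) e₂) := by
  have hx := mem_chart_source E4 x
  have hm := h.isMetricConnection τ
  have ht := (isOpen_extChartAt_target (I := 𝓡 4) x).mem_nhds (extChartAt_mem_target hx)
  let A : TangentSpace (𝓡 4) x →ₗ[ℝ] TangentSpace (𝓡 4) x :=
    (ofTangentCoord (E := E4) x x : E4 →ₗ[ℝ] TangentSpace (𝓡 4) x) ∘ₗ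
      christoffelCurvatureHom (christoffel nabla x) (extChartAt (𝓡 4) x x)
        (tangentCoord x x l) (tangentCoord x x l) ∘ₗ
      (tangentCoord (E := E4) x x : TangentSpace (𝓡 4) x →ₗ[ℝ] E4)
  have hA (w) : A w = nabla.curvature x w l l := (h.curvature_eq τ x w l l).symm
  have hev {Q : E4 → Prop} (hQ : ∀ y ∈ (chartAt E4 x).source, Q (extChartAt (𝓡 4) x y)) :
      ∀ᶠ z in 𝓝 (extChartAt (𝓡 4) x x), Q z := by
    filter_upwards [ht] with z hz
    obtain ⟨y, hy, rfl⟩ := exists_eq_extChartAt hz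
    exact hQ y hy
  simp only [← hA]
  rw [← (τ.isLorentzForm x).trace_eq hl hll h1 h2 h12 hl1 hl2 ?_ ?_ (g.frame x),
    LorentzianMetric.ricci]
  · simp only [hA]
  · rw [hA, h.curvature_eq τ]
    simp [christoffelCurvature]
  · intro w
    rw [hA, h.curvature_eq τ, ← metricCoord_apply hx, tangentCoord_ofTangentCoord hx]
    refine metric_christoffelCurvature_self
      (((contDiffOn_metricCoord g.contMDiff).contDiffAt ht).of_le
        (WithTop.coe_le_coe.2 (le_top : (2 : ℕ∞) ≤ ⊤)))
      ((hm.contDiffOn_christoffel.contDiffAt ht).differentiableAt (by simp)) (hev ?_) (hev ?_) _ _ _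
    · intro y hy a b
      rw [metricCoord_apply_constField hy, g.symm, ← metricCoord_apply_constField hy]
    · exact fun y hy a b v ↦ hm.fderiv_metricCoord hy a b v

end Horizon

/-! ### Vanishing of the second fundamental form of a non-expanding horizon -/

section Horizon

variable {M : Type*} [TopologicalSpace M] [ChartedSpace E4 M] [IsManifold (𝓡 4) ∞ M]
  {H : Type*} [TopologicalSpace H] [ChartedSpace E3 H] [IsManifold (𝓡 3) ∞ H]
  {g : LorentzianMetric M} {τ : TimeOrientation g} {nabla : AffineConnection M}
  {T : Π x : M, TangentSpace (𝓡 4) x →ₗ[ℝ] TangentSpace (𝓡 4) x →ₗ[ℝ] ℝ} {ψ : H → M}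

/-- The metric in the chart at `x₀` is Lorentzian. -/
lemma TimeOrientation.isLorentzForm_metricCoord (τ : TimeOrientation g) {x₀ y : M}
    (hy : y ∈ (chartAt E4 x₀).source) :
    IsLorentzForm (metricCoord g.inner x₀ (extChartAt (𝓡 4) x₀ y))
      (tangentCoord x₀ y (τ.field y)) where
  symm a b := by
    rw [metricCoord_apply_constField hy, g.symm, ← metricCoord_apply_constField hy]
  pos := by
    rw [metricCoord_apply hy]
    exact τ.timelike y
  neg v hv hv0 := by
    rw [← tangentCoord_ofTangentCoord hy v, metricCoord_apply hy] at hv ⊢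
    refine (τ.isLorentzForm y).neg _ hv fun h0 ↦ hv0 ?_
    rw [← tangentCoord_ofTangentCoord hy v, h0, map_zero]

namespace IsNonExpandingHorizon

variable {μ : Π p : H, TangentSpace (𝓡 3) p}

omit [IsManifold (𝓡 3) ∞ H] in
lemma injective (hH : IsNonExpandingHorizon g τ nabla T ψ) (p : H) :
    Function.Injective (pushforward ψ p) :=
  (hH.embedding.isImmersion.isImmersionAt p).mfderiv_injective

lemma isNullNormal (hH : IsNonExpandingHorizon g τ nabla T ψ)
    (hτ : ∀ p, g.inner (ψ p) (τ.field (ψ p)) (pushforward ψ p (μ p)) = 1)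
    (hn : ∀ p X, g.inner (ψ p) (pushforward ψ p (μ p)) (pushforward ψ p X) = 0) :
    IsNullNormal g ψ (alongField ψ μ) where
  contMDiff := contMDiff_of_normal τ hH.embedding hτ hn
  ne_zero p h0 := by
    have := hτ p
    rw [show pushforward ψ p (μ p) = 0 from h0, map_zero] at this
    exact zero_ne_one this
  null p := hn p _
  normal := hn

/-- The Ricci tensor is nonnegative on the null normal. -/
lemma ricci_nonneg (hH : IsNonExpandingHorizon g τ nabla T ψ)
    (hτ : ∀ p, g.inner (ψ p) (τ.field (ψ p)) (pushforward ψ p (μ p)) = 1)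
    (hn : ∀ p X, g.inner (ψ p) (pushforward ψ p (μ p)) (pushforward ψ p X) = 0) (p : H) :
    0 ≤ g.ricci nabla (ψ p) (pushforward ψ p (μ p)) (pushforward ψ p (μ p)) := by
  have hf (p : H) : τ.IsFuturePointing (ψ p) (alongField ψ μ p) :=
    ⟨(hn p _).ge, by rw [alongField, hτ]; exact zero_le_one⟩
  obtain ⟨Q, hQ, hQf⟩ := hH.energy _ (hH.isNullNormal hτ hn) hf p
  -- The product of `Q` with the normal is `T(l, l)`, so the energy condition makes it nonnegative.
  have h1 := (τ.isLorentzForm (ψ p)).nonneg_of_future hQf.1 hQf.2 (hf p).1 (hf p).2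
  rw [hQ] at h1
  have h2 := hH.einstein p (pushforward ψ p (μ p)) (pushforward ψ p (μ p))
  -- The scalar curvature term drops out because the normal is null.
  rw [hn, mul_zero, sub_zero] at h2
  rw [h2]
  exact mul_nonneg (by positivity) h1

/-- The second fundamental form of a non-expanding horizon vanishes. -/
lemma nullSecondForm_eq_zero (hH : IsNonExpandingHorizon g τ nabla T ψ)
    (hnabla : g.IsLeviCivita nabla)
    (hτ : ∀ p, g.inner (ψ p) (τ.field (ψ p)) (pushforward ψ p (μ p)) = 1)
    (hn : ∀ p X, g.inner (ψ p) (pushforward ψ p (μ p)) (pushforward ψ p X) = 0) (p : H)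
    (X Y : E3) :
    nullSecondForm (metricCoord g.inner (ψ p)) (christoffel nabla (ψ p)) (mapCoord ψ p (ψ p))
      (fieldCoord ψ p (ψ p) (alongField ψ μ)) (extChartAt (𝓡 3) p p) X Y = 0 := by
  have hp := mem_chart_source E3 p
  have hx := mem_chart_source E4 (ψ p)
  have hψ := hH.embedding.contMDiff
  have hψd (q) : MDifferentiableAt (𝓡 3) (𝓡 4) ψ q := hψ.contMDiffAt.mdifferentiableAt (by simp)
  have hm := hnabla.isMetricConnection τ
  have hl := hH.isNullNormal hτ hn
  have h3 : (3 : ℕ∞ω) ≤ ∞ := WithTop.coe_le_coe.2 (le_top : (3 : ℕ∞) ≤ ⊤)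
  have h1 : (1 : ℕ∞ω) ≤ ∞ := WithTop.coe_le_coe.2 (le_top : (1 : ℕ∞) ≤ ⊤)
  have ht := (isOpen_extChartAt_target (I := 𝓡 4) (ψ p)).mem_nhds (extChartAt_mem_target hx)
  set u₀ := extChartAt (𝓡 3) p p with hu₀
  set f := mapCoord (E := E4) (F := E3) ψ p (ψ p) with hf
  set G := metricCoord g.inner (ψ p) with hG
  set Γ := christoffel nabla (ψ p) with hΓ
  set l := fieldCoord (E := E4) (F := E3) ψ p (ψ p) (alongField ψ μ) with hl'
  have hfp : f u₀ = extChartAt (𝓡 4) (ψ p) (ψ p) := mapCoord_apply hp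
  obtain ⟨S, hS, hSf⟩ :=
    (hH.embedding.isImmersion.isImmersionAt p).exists_leftInverse_fderiv
  have hfs : ContDiffAt ℝ ∞ f u₀ := contDiffAt_mapCoord hp hx hψ
  have hls : ContDiffAt ℝ ∞ l u₀ := (contMDiffAt_iff_comp_symm (n := ⊤) hp).1
    ((contMDiffAt_field_along_iff (n := ⊤) hx hψ.contMDiffAt).1 (hl.contMDiff p))
  have hevH {Q : E3 → Prop} (hQ : ∀ q ∈ (chartAt E3 p).source, ψ q ∈ (chartAt E4 (ψ p)).source →
      Q (extChartAt (𝓡 3) p q)) : ∀ᶠ u in 𝓝 u₀, Q u := by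
    filter_upwards [eventually_exists_extChartAt_eq hp
      (hψ.continuous.continuousAt.eventually (eventually_mem_source hx))] with u
    rintro ⟨q, hq, rfl, hxq⟩
    exact hQ q hq hxq
  have hevM {Q : E4 → Prop} (hQ : ∀ y ∈ (chartAt E4 (ψ p)).source, Q (extChartAt (𝓡 4) (ψ p) y)) :
      ∀ᶠ z in 𝓝 (f u₀), Q z := by
    rw [hfp]
    filter_upwards [ht] with z hz
    obtain ⟨y, hy, rfl⟩ := exists_eq_extChartAt hz
    exact hQ y hy
  have hGpush {q : H} (hq : q ∈ (chartAt E3 p).source) (hxq : ψ q ∈ (chartAt E4 (ψ p)).source)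
      (w : TangentSpace (𝓡 4) (ψ q)) (X : E3) :
      G (f (extChartAt (𝓡 3) p q)) (tangentCoord (ψ p) (ψ q) w)
        (fderiv ℝ f (extChartAt (𝓡 3) p q) X) =
        g.inner (ψ q) w (pushforward ψ q (ofTangentCoord p q X)) := by
    rw [← metricCoord_apply (B := g.inner) hxq, ← fderiv_mapCoord hq hxq (hψd q),
      tangentCoord_ofTangentCoord hq, ← mapCoord_apply hq]
  have hDf {q : H} (hq : q ∈ (chartAt E3 p).source) (hxq : ψ q ∈ (chartAt E4 (ψ p)).source)
      (X : E3) : fderiv ℝ f (extChartAt (𝓡 3) p q) X =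
        tangentCoord (ψ p) (ψ q) (pushforward ψ q (ofTangentCoord p q X)) := by
    rw [← fderiv_mapCoord hq hxq (hψd q), tangentCoord_ofTangentCoord hq]
  have hpush {q : H} (hq : q ∈ (chartAt E3 p).source) (hxq : ψ q ∈ (chartAt E4 (ψ p)).source)
      (X Y : E3) : G (f (extChartAt (𝓡 3) p q)) (fderiv ℝ f (extChartAt (𝓡 3) p q) X)
        (fderiv ℝ f (extChartAt (𝓡 3) p q) Y) = g.inner (ψ q)
          (pushforward ψ q (ofTangentCoord p q X)) (pushforward ψ q (ofTangentCoord p q Y)) := by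
    rw [hDf hq hxq X, hGpush hq hxq]
  have hlq {q : H} (hq : q ∈ (chartAt E3 p).source) : l (extChartAt (𝓡 3) p q) =
      tangentCoord (ψ p) (ψ q) (pushforward ψ q (μ q)) := fieldCoord_apply hq _
  -- The field `μ` was chosen pointwise. Applying the smooth left inverse `S` of `df` to the smooth
  -- normal shows that the generator is regular in coordinates.
  have hpar : ParamNullHypersurfaceAt G Γ f l (fun u ↦ S u (l u)) u₀ := by
    refine ⟨hfs.of_le h3, hls.of_le h3, (hS.clm_apply hls).of_le h1, ?_, ?_, ?_, ?_, ?_, ?_, ?_⟩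
    · rw [hfp]
      exact ((contDiffOn_metricCoord g.contMDiff).contDiffAt ht).of_le h1
    · rw [hfp]
      exact (hm.contDiffOn_christoffel.contDiffAt ht).of_le h1
    · exact hevM fun y hy ↦ (τ.isLorentzForm_metricCoord hy).symm
    · exact hevM fun y hy ↦ hm.christoffel_symm hy
    · exact hevM fun y hy ↦ hm.fderiv_metricCoord hy
    · filter_upwards [hSf, hevH (Q := fun u ↦ ∃ X, l u = fderiv ℝ f u X) fun q hq hxq ↦ ⟨tangentCoord p q (μ q), by
          rw [hDf hq hxq, ofTangentCoord_tangentCoord hq, hlq hq]⟩] with u hu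
      rintro ⟨X, hX⟩
      rw [hX, hu]
    · refine hevH fun q hq hxq X ↦ ?_
      rw [hlq hq, hGpush hq hxq, hn]
  have hLor : IsLorentzForm (G (f u₀)) (tangentCoord (ψ p) (ψ p) (τ.field (ψ p))) := by
    rw [hfp]
    exact τ.isLorentzForm_metricCoord hx
  have hinj : Function.Injective (fderiv ℝ f u₀) := fun X Y hXY ↦ by
    rw [← hSf.self_of_nhds X, ← hSf.self_of_nhds Y]
    exact congrArg _ hXY
  have hleq := hpar.normal_eq.self_of_nhds
  have hl0 : l u₀ ≠ 0 := by
    rw [hu₀, hlq hp]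
    intro h0
    refine hl.ne_zero p ?_
    rw [← ofTangentCoord_tangentCoord hx (alongField ψ μ p)]
    exact (congrArg _ h0).trans (map_zero _)
  have hμ0 : S u₀ (l u₀) ≠ 0 := fun h0 ↦ hl0 (by rw [hleq, h0, map_zero])
  have hnull : ∀ X, G (f u₀) (fderiv ℝ f u₀ (S u₀ (l u₀))) (fderiv ℝ f u₀ X) = 0 := by
    intro X
    rw [← hleq]
    exact hpar.normal.self_of_nhds X
  have hdim : Module.finrank ℝ E4 = Module.finrank ℝ E3 + 1 := by simp
  obtain ⟨X₁, X₂, h11, h22, h12, hspan⟩ :=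
    hLor.exists_orthonormal (ι := (fderiv ℝ f u₀ : E3 →ₗ[ℝ] E4)) hinj hμ0 hnull (by simp)
  refine hpar.nullSecondForm_eq_zero ?_ ?_ ?_ h11 h22 h12 hspan ?_ X Y
  · refine hevH fun q hq hxq e₁ e₂ h11 h22 h12 ↦ ?_
    rw [hpush hq hxq] at h11 h22 h12
    -- The expansion is tested on smooth extensions of the normal, so one must be exhibited at each
    -- nearby point before the hypothesis says anything.
    obtain ⟨L, hLψ, -, hLs⟩ :=
      (hH.embedding.isImmersion.isImmersionAt q).exists_extension (alongField ψ μ)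
    have hLs' := hLs ((contMDiffAt_field_along_iff (n := ⊤) (mem_chart_source E4 (ψ q))
      hψ.contMDiffAt).1 (hl.contMDiff q))
    have hexp := hH.expansion _ hl q L hLs' hLψ _ _ h11 h22 h12
    have hK (e : E3) : nullSecondForm G Γ f l (extChartAt (𝓡 3) p q) e e = g.inner (ψ q)
        (nabla L (ψ q) (pushforward ψ q (ofTangentCoord p q e)))
        (pushforward ψ q (ofTangentCoord p q e)) := by
      have h := tangentCoord_covariantDerivative_along (nabla := nabla) hq hxq (hψd q)
        (hLs'.mdifferentiableAt (by simp)) hLψ (ofTangentCoord p q e)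
      rw [tangentCoord_ofTangentCoord hq] at h
      rw [nullSecondForm, ← h, hGpush hq hxq]
    rw [hK, hK]
    linarith
  · intro v hv
    rw [hleq]
    exact hLor.eq_smul_of_orthogonal (ι := (fderiv ℝ f u₀ : E3 →ₗ[ℝ] E4)) hinj hμ0 hnull hdim hv
  · intro v hv
    rw [hleq] at hv
    exact hLor.mem_range_of_orthogonal_null (ι := (fderiv ℝ f u₀ : E3 →ₗ[ℝ] E4))
      hinj hμ0 hnull hdim hv
  · rw [hu₀] at h11 h22 h12 ⊢
    have h11' := (hpush hp hx X₁ X₁).symm.trans h11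
    have h22' := (hpush hp hx X₂ X₂).symm.trans h22
    have h12' := (hpush hp hx X₁ X₂).symm.trans h12
    have hR := hnabla.ricci_null τ (hl.ne_zero p) (hl.null p) h11' h22' h12'
      (hl.normal p _) (hl.normal p _)
    have hR0 : 0 ≤ g.ricci nabla (ψ p) (alongField ψ μ p) (alongField ψ μ p) :=
      hH.ricci_nonneg hτ hn p
    have hA (X : E3) : G (f (extChartAt (𝓡 3) p p)) (christoffelCurvature Γ
        (f (extChartAt (𝓡 3) p p)) (fderiv ℝ f (extChartAt (𝓡 3) p p) X)
        (l (extChartAt (𝓡 3) p p)) (l (extChartAt (𝓡 3) p p)))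
        (fderiv ℝ f (extChartAt (𝓡 3) p p) X) =
        g.inner (ψ p) (nabla.curvature (ψ p) (pushforward ψ p (ofTangentCoord p p X))
          (alongField ψ μ p) (alongField ψ μ p)) (pushforward ψ p (ofTangentCoord p p X)) := by
      rw [hnabla.curvature_eq τ, ← hGpush hp hx, tangentCoord_ofTangentCoord hx, hDf hp hx,
        hlq hp, ← hfp]
      rfl
    rw [hA, hA]
    rw [hR] at hR0
    linarith

end IsNonExpandingHorizon

end Horizon

/-! ### The induced connection -/

section Induced

variable {M : Type*} [TopologicalSpace M] [ChartedSpace E4 M] [IsManifold (𝓡 4) ∞ M]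
  {H : Type*} [TopologicalSpace H] [ChartedSpace E3 H] [IsManifold (𝓡 3) ∞ H]
  {g : LorentzianMetric M} {τ : TimeOrientation g} {nabla : AffineConnection M}
  {T : Π x : M, TangentSpace (𝓡 4) x →ₗ[ℝ] TangentSpace (𝓡 4) x →ₗ[ℝ] ℝ} {ψ : H → M}

/-- A differentiable vector field on an embedded hypersurface has a differentiable extension. -/
lemma exists_extendsAt (hψ : Manifold.IsSmoothEmbedding (𝓡 3) (𝓡 4) ∞ ψ) (p : H)
    {Y : Π q : H, TangentSpace (𝓡 3) q} (hY : FieldDiffAt Y p) :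
    ∃ Z : Π x : M, TangentSpace (𝓡 4) x,
      FieldDiffAt Z (ψ p) ∧ ExtendsAt ψ Z (alongField ψ Y) p := by
  obtain ⟨Z, hZ, hZd, -⟩ := (hψ.isImmersion.isImmersionAt p).exists_extension (alongField ψ Y)
  exact ⟨Z, hZd (mdifferentiableAt_tangentCoord_mfderiv (mem_chart_source E4 (ψ p))
    hψ.contMDiff hY), hZ⟩

/-- Independence of the extension: in tangential directions both sides are the derivative `covAlong`
of the common restriction `W`. -/
lemma covariantDerivative_congr_along (hψ : Manifold.IsSmoothEmbedding (𝓡 3) (𝓡 4) ∞ ψ) {p : H}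
    {W : Π q : H, TangentSpace (𝓡 4) (ψ q)} {Z Z' : Π x : M, TangentSpace (𝓡 4) x}
    (hZ : FieldDiffAt Z (ψ p)) (hZ' : FieldDiffAt Z' (ψ p)) (hZW : ExtendsAt ψ Z W p)
    (hZW' : ExtendsAt ψ Z' W p) (X : TangentSpace (𝓡 3) p) :
    nabla Z (ψ p) (pushforward ψ p X) = nabla Z' (ψ p) (pushforward ψ p X) := by
  have hp := mem_chart_source E3 p
  have hx := mem_chart_source E4 (ψ p)
  have hd : MDifferentiableAt (𝓡 3) (𝓡 4) ψ p :=
    hψ.contMDiff.contMDiffAt.mdifferentiableAt (by simp)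
  rw [← ofTangentCoord_tangentCoord hx (nabla Z (ψ p) _),
    tangentCoord_covariantDerivative_along hp hx hd hZ hZW,
    ← tangentCoord_covariantDerivative_along hp hx hd hZ' hZW', ofTangentCoord_tangentCoord hx]

namespace IsNonExpandingHorizon

/-- Covariant derivatives of tangential vector fields along the horizon are tangential. -/
lemma exists_pushforward_eq (hH : IsNonExpandingHorizon g τ nabla T ψ)
    (hnabla : g.IsLeviCivita nabla) {p : H} {Y : Π q : H, TangentSpace (𝓡 3) q}
    (hY : FieldDiffAt Y p) {Z : Π x : M, TangentSpace (𝓡 4) x} (hZ : FieldDiffAt Z (ψ p))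
    (hZY : ExtendsAt ψ Z (alongField ψ Y) p) (X : TangentSpace (𝓡 3) p) :
    ∃ V : TangentSpace (𝓡 3) p, nabla Z (ψ p) (pushforward ψ p X) = pushforward ψ p V := by
  choose μ hμ hτ hn using hH.null.exists_generator τ hH.injective
  have hp := mem_chart_source E3 p
  have hx := mem_chart_source E4 (ψ p)
  have hψ := hH.embedding.contMDiff
  have hψd : MDifferentiableAt (𝓡 3) (𝓡 4) ψ p := hψ.contMDiffAt.mdifferentiableAt (by simp)
  have hm := hnabla.isMetricConnection τ
  have hl := hH.isNullNormal hτ hn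
  refine (τ.isLorentzForm (ψ p)).mem_range_of_orthogonal_null
    (ι := (pushforward ψ p : TangentSpace (𝓡 3) p →ₗ[ℝ] TangentSpace (𝓡 4) (ψ p)))
    (hH.injective p) (hμ p) (hn p) (show Module.finrank ℝ E4 = Module.finrank ℝ E3 + 1 by simp) ?_
  have hf : ContDiffAt ℝ ∞ (mapCoord (E := E4) (F := E3) ψ p (ψ p)) (extChartAt (𝓡 3) p p) :=
    contDiffAt_mapCoord hp hx hψ
  have hls : ContDiffAt ℝ ∞ (fieldCoord (E := E4) (F := E3) ψ p (ψ p) (alongField ψ μ))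
      (extChartAt (𝓡 3) p p) := (contMDiffAt_iff_comp_symm (n := ⊤) hp).1
    ((contMDiffAt_field_along_iff (n := ⊤) hx hψ.contMDiffAt).1 (hl.contMDiff p))
  have hW : DifferentiableAt ℝ (fieldCoord (E := E4) (F := E3) ψ p (ψ p) (alongField ψ Y))
      (extChartAt (𝓡 3) p p) :=
    mdifferentiableAt_comp_symm hp (mdifferentiableAt_tangentCoord_mfderiv hx hψ hY)
  have hfp : mapCoord (E := E4) (F := E3) ψ p (ψ p) (extChartAt (𝓡 3) p p) =
    extChartAt (𝓡 4) (ψ p) (ψ p) := mapCoord_apply hp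
  have ht := (isOpen_extChartAt_target (I := 𝓡 4) (ψ p)).mem_nhds (extChartAt_mem_target hx)
  have h0 : (fun u ↦ metricCoord g.inner (ψ p) (mapCoord (E := E4) (F := E3) ψ p (ψ p) u)
      (fieldCoord (E := E4) (F := E3) ψ p (ψ p) (alongField ψ Y) u)
      (fieldCoord (E := E4) (F := E3) ψ p (ψ p) (alongField ψ μ) u))
      =ᶠ[𝓝 (extChartAt (𝓡 3) p p)] fun _ ↦ 0 := by
    filter_upwards [eventually_exists_extChartAt_eq hp
      (hψ.continuous.continuousAt.eventually (eventually_mem_source hx))] with u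
    rintro ⟨q, hq, rfl, hxq⟩
    rw [mapCoord_apply hq, fieldCoord_apply hq, fieldCoord_apply hq, metricCoord_apply hxq, g.symm]
    exact hn q (Y q)
  -- Differentiating `g(Y, l) = 0` gives `g(∇_X Y, l) + g(Y, ∇_X l) = 0`. The second term is the
  -- second fundamental form, which vanishes by `h2`.
  have h1 := fderiv_metric_along (Γ := christoffel nabla (ψ p)) (hf.differentiableAt (by simp)) hW
    (hls.differentiableAt (by simp)) (by
      rw [hfp]
      exact ((contDiffOn_metricCoord g.contMDiff).contDiffAt ht).differentiableAt (by simp))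
    (by rw [hfp]; exact hm.fderiv_metricCoord hx) (tangentCoord p p X)
  rw [h0.fderiv_eq, ← tangentCoord_covariantDerivative_along hp hx hψd hZ hZY, fieldCoord_apply hp,
    fieldCoord_apply hp] at h1
  have h2 := hH.nullSecondForm_eq_zero hnabla hτ hn p (tangentCoord p p X) (tangentCoord p p (Y p))
  rw [nullSecondForm, fderiv_mapCoord hp hx hψd, hfp,
    (τ.isLorentzForm_metricCoord hx).symm] at h2
  rw [hfp, metricCoord_apply hx, show alongField ψ Y p = mfderiv (𝓡 3) (𝓡 4) ψ p (Y p) from rfl,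
    h2] at h1
  have h3 : g.inner (ψ p) (nabla Z (ψ p) (pushforward ψ p X)) (alongField ψ μ p) = 0 := by
    simpa using h1.symm
  exact h3

/-- The connection induced on a non-expanding horizon. -/
lemma exists_inducedConnection (hH : IsNonExpandingHorizon g τ nabla T ψ)
    (hnabla : g.IsLeviCivita nabla) :
    ∃ D : CovariantDerivative (𝓡 3) E3 (fun p : H ↦ TangentSpace (𝓡 3) p),
      IsInducedBy nabla ψ D := by
  classical
  have key (Y : Π q : H, TangentSpace (𝓡 3) q) (p : H) :
      ∃ A : TangentSpace (𝓡 3) p →L[ℝ] TangentSpace (𝓡 3) p, FieldDiffAt Y p →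
        ∀ (Z : Π x : M, TangentSpace (𝓡 4) x) (X : TangentSpace (𝓡 3) p),
          FieldDiffAt Z (ψ p) → ExtendsAt ψ Z (alongField ψ Y) p →
          pushforward ψ p (A X) = nabla Z (ψ p) (pushforward ψ p X) := by
    by_cases hY : FieldDiffAt Y p
    · obtain ⟨Z, hZ, hZY⟩ := exists_extendsAt hH.embedding p hY
      obtain ⟨S, -, hS⟩ :=
        (hH.embedding.isImmersion.isImmersionAt p).exists_leftInverse_fderiv
      have hp := mem_chart_source E3 p
      have hx := mem_chart_source E4 (ψ p)
      -- A linear left inverse of `dψ`. Since the derivative is known to be tangent, composing with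
      -- `R` recovers it as a vector of the horizon, linearly in `X`.
      let R : TangentSpace (𝓡 4) (ψ p) →L[ℝ] TangentSpace (𝓡 3) p :=
        ofTangentCoord p p ∘L S (extChartAt (𝓡 3) p p) ∘L tangentCoord (ψ p) (ψ p)
      have hR (X) : R (pushforward ψ p X) = X := by
        simp only [R, ContinuousLinearMap.comp_apply]
        rw [← fderiv_mapCoord hp hx
          (hH.embedding.contMDiff.contMDiffAt.mdifferentiableAt (by simp)),
          hS.self_of_nhds, ofTangentCoord_tangentCoord hp]
      refine ⟨R ∘L nabla Z (ψ p) ∘L pushforward ψ p, fun _ Z' X hZ' hZY' ↦ ?_⟩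
      obtain ⟨V, hV⟩ := hH.exists_pushforward_eq hnabla hY hZ hZY X
      change pushforward ψ p (R (nabla Z (ψ p) (pushforward ψ p X))) = _
      rw [covariantDerivative_congr_along hH.embedding hZ' hZ hZY' hZY, hV, hR]
    · exact ⟨0, fun h ↦ absurd h hY⟩
  choose D hD using key
  refine ⟨⟨D, ⟨?_, ?_⟩⟩, fun p X Y Z hY hZ hZY ↦ hD Y p hY Z X hZ hZY⟩
  · intro Y Y' p hY hY' _
    obtain ⟨Z, hZ, hZY⟩ := exists_extendsAt hH.embedding p hY
    obtain ⟨Z', hZ', hZY'⟩ := exists_extendsAt hH.embedding p hY'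
    ext1 X
    refine hH.injective p ?_
    have h1 : FieldDiffAt (Z + Z') (ψ p) := mdifferentiableAt_add_section hZ hZ'
    have h2 : ExtendsAt ψ (Z + Z') (alongField ψ (Y + Y')) p := by
      filter_upwards [hZY, hZY'] with q hq hq'
      simp [hq, hq', alongField]
    rw [hD _ p (mdifferentiableAt_add_section hY hY') _ X h1 h2, add_apply, map_add,
      hD _ p hY _ X hZ hZY, hD _ p hY' _ X hZ' hZY',
      nabla.isCovariantDerivativeOnUniv.add hZ hZ', add_apply]
  · intro Y a p hY ha _
    obtain ⟨Z, hZ, hZY⟩ := exists_extendsAt hH.embedding p hY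
    obtain ⟨r, hr, hrψ⟩ :=
      (hH.embedding.isImmersion.isImmersionAt p).exists_local_leftInverse
    have hrp := hrψ.self_of_nhds
    -- The function `a` is extended off the horizon by `a ∘ r`, so `(a ∘ r) • Z` extends `a • Y` and
    -- the Leibniz rule of `nabla` descends.
    have har : MDifferentiableAt (𝓡 4) 𝓘(ℝ, ℝ) (a ∘ r) (ψ p) :=
      ha.comp_of_eq _ (hr.mdifferentiableAt (by simp)) hrp
    ext1 X
    refine hH.injective p ?_
    have h1 : FieldDiffAt ((a ∘ r) • Z) (ψ p) := har.smul_section hZ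
    have h2 : ExtendsAt ψ ((a ∘ r) • Z) (alongField ψ (a • Y)) p := by
      filter_upwards [hZY, hrψ] with q hq hq'
      simp [hq, hq', alongField]
    have h3 : mvfderiv (𝓡 4) (a ∘ r) (ψ p) (pushforward ψ p X) = mvfderiv (𝓡 3) a p X := by
      have h4 := mfderiv_comp p har
        (hH.embedding.contMDiff.contMDiffAt.mdifferentiableAt (by simp))
      have h5 : (a ∘ r) ∘ ψ =ᶠ[𝓝 p] a := hrψ.mono fun q hq ↦ congrArg a hq
      rw [h5.mfderiv_eq] at h4
      exact (congrArg (fun A ↦ A X) h4).symm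
    rw [hD _ p (ha.smul_section hY) _ X h1 h2,
      nabla.isCovariantDerivativeOnUniv.leibniz hZ har, add_apply, smul_apply, add_apply,
      smul_apply, map_add, map_smul, hD _ p hY _ X hZ hZY, ContinuousLinearMap.smulRight_apply,
      ContinuousLinearMap.smulRight_apply, h3, map_smul, hZY.self_of_nhds, Function.comp_apply, hrp]
    rfl

end IsNonExpandingHorizon

/-- A connection induced on an embedded hypersurface is smooth. -/
lemma IsInducedBy.contMDiff (hψ : Manifold.IsSmoothEmbedding (𝓡 3) (𝓡 4) ∞ ψ)
    (hm : IsMetricConnection g.inner nabla)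
    {D : CovariantDerivative (𝓡 3) E3 (fun p : H ↦ TangentSpace (𝓡 3) p)}
    (hD : IsInducedBy nabla ψ D) : D.ContMDiffCovariantDerivative ∞ := by
  refine ⟨⟨fun {σ} hσ ↦ contMDiffOn_univ.2 fun p ↦ ?_⟩⟩
  have hσ : ContMDiff (𝓡 3) ((𝓡 3).prod 𝓘(ℝ, E3)) ∞ (T% σ) := by
    rw [contMDiffOn_univ] at hσ
    exact hσ.of_le (by simp)
  have hp := mem_chart_source E3 p
  have hx := mem_chart_source E4 (ψ p)
  have hψd (q) : MDifferentiableAt (𝓡 3) (𝓡 4) ψ q :=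
    hψ.contMDiff.contMDiffAt.mdifferentiableAt (by simp)
  have ht := (isOpen_extChartAt_target (I := 𝓡 4) (ψ p)).mem_nhds (extChartAt_mem_target hx)
  rw [contMDiffAt_hom_bundle]
  refine ⟨contMDiffAt_id, ?_⟩
  obtain ⟨S, hS, hSf⟩ := (hψ.isImmersion.isImmersionAt p).exists_leftInverse_fderiv
  let f := mapCoord (E := E4) (F := E3) ψ p (ψ p)
  let W := fieldCoord (E := E4) (F := E3) ψ p (ψ p) (alongField ψ σ)
  have hf : ContDiffAt ℝ ∞ f (extChartAt (𝓡 3) p p) := contDiffAt_mapCoord hp hx hψ.contMDiff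
  have hfp : f (extChartAt (𝓡 3) p p) = extChartAt (𝓡 4) (ψ p) (ψ p) := mapCoord_apply hp
  have hf' : ContDiffAt ℝ ∞ (fderiv ℝ f) (extChartAt (𝓡 3) p p) := hf.fderiv_right (by simp)
  have hW : ContDiffAt ℝ ∞ W (extChartAt (𝓡 3) p p) := by
    have h1 := (contMDiffAt_iff_comp_symm (n := ⊤) hp).1
      ((contMDiffAt_field_iff (n := ⊤) hp).1 (hσ p))
    refine (hf'.clm_apply h1).congr_of_eventuallyEq ?_
    filter_upwards [eventually_exists_extChartAt_eq hp
      (eventually_tangentCoord_mfderiv hp hx hψ.contMDiff)] with u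
    rintro ⟨q, hq, rfl, hq'⟩
    refine (fieldCoord_apply hq _).trans ((hq' _).trans ?_)
    congr 1
    exact (fieldCoord_apply (ψ := id) hq σ).symm
  have hΓ : ContDiffAt ℝ ∞ (fun u ↦ christoffel nabla (ψ p) (f u)) (extChartAt (𝓡 3) p p) := by
    refine ContDiffAt.comp (g := christoffel nabla (ψ p)) _ ?_ hf
    rw [hfp]
    exact hm.contDiffOn_christoffel.contDiffAt ht
  -- In coordinates the induced derivative is `S` composed with the derivative along `f`, and every
  -- ingredient of this expression is smooth.
  have hA : ContDiffAt ℝ ∞ (fun u ↦ S u ∘L covAlong (christoffel nabla (ψ p)) f W u)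
      (extChartAt (𝓡 3) p p) :=
    hS.clm_comp ((hW.fderiv_right (by simp)).add ((hΓ.clm_apply hW).clm_comp hf'))
  have hA' := ContMDiffAt.comp (I' := 𝓘(ℝ, E3)) p hA.contMDiffAt
    (contMDiffAt_extChartAt_of_mem (n := ⊤) hp)
  refine hA'.congr_of_eventuallyEq ?_
  filter_upwards [eventually_mem_source hp,
    hψ.contMDiff.continuous.continuousAt.eventually (eventually_mem_source hx),
    (contMDiffAt_extChartAt_of_mem (n := 0) hp).continuousAt.eventually hSf] with q hq hxq hSq
  ext1 X
  change tangentCoord p q (D σ q (ofTangentCoord p q X)) =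
    S (extChartAt (𝓡 3) p q) (covAlong (christoffel nabla (ψ p)) f W (extChartAt (𝓡 3) p q) X)
  have hσd : FieldDiffAt σ q := (hσ q).mdifferentiableAt (by simp)
  obtain ⟨Z, hZ, hZσ⟩ := exists_extendsAt hψ q hσd
  have h1 := tangentCoord_covariantDerivative_along (nabla := nabla) hq hxq (hψd q) hZ hZσ
    (ofTangentCoord p q X)
  rw [tangentCoord_ofTangentCoord hq, ← hD q _ σ Z hσd hZ hZσ,
    ← fderiv_mapCoord hq hxq (hψd q)] at h1
  rw [← h1, hSq]

end Induced

theorem mainTheorem3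
    {M : Type*} [TopologicalSpace M] [T2Space M] [SecondCountableTopology M]
    [ChartedSpace E4 M] [IsManifold (𝓡 4) ∞ M]
    {H : Type*} [TopologicalSpace H] [ChartedSpace E3 H] [IsManifold (𝓡 3) ∞ H]
    (g : LorentzianMetric M) (τ : TimeOrientation g)
    (nabla : AffineConnection M) (hnabla : g.IsLeviCivita nabla)
    (T : Π x : M, TangentSpace (𝓡 4) x →ₗ[ℝ] TangentSpace (𝓡 4) x →ₗ[ℝ] ℝ)
    (ψ : H → M) (hH : IsNonExpandingHorizon g τ nabla T ψ) :
    (∀ (p : H) (Y : Π q : H, TangentSpace (𝓡 3) q), FieldDiffAt Y p →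
      ∃ Z : Π x : M, TangentSpace (𝓡 4) x,
        FieldDiffAt Z (ψ p) ∧ ExtendsAt ψ Z (alongField ψ Y) p) ∧
    ∃ D : CovariantDerivative (𝓡 3) E3 (fun p : H ↦ TangentSpace (𝓡 3) p),
      IsInducedBy nabla ψ D ∧
      (∀ D' : CovariantDerivative (𝓡 3) E3 (fun p : H ↦ TangentSpace (𝓡 3) p),
        IsInducedBy nabla ψ D' →
        ∀ (p : H) (Y : Π q : H, TangentSpace (𝓡 3) q), FieldDiffAt Y p → D' Y p = D Y p) ∧
      D.ContMDiffCovariantDerivative ∞ := by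
  refine ⟨fun p Y hY ↦ exists_extendsAt hH.embedding p hY, ?_⟩
  obtain ⟨D, hD⟩ := hH.exists_inducedConnection hnabla
  refine ⟨D, hD, fun D' hD' p Y hY ↦ ?_, hD.contMDiff hH.embedding (hnabla.isMetricConnection τ)⟩
  -- Uniqueness: a single extension determines the push-forwards of both derivatives, and `dψ` is
  -- injective.
  obtain ⟨Z, hZ, hZY⟩ := exists_extendsAt hH.embedding p hY
  ext1 X
  exact hH.injective p ((hD' p X Y Z hY hZ hZY).trans (hD p X Y Z hY hZ hZY).symm)
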